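/- Let $q\ge 12/11$ and $\pi_q=\frac{2\pi}{q\sin(\pi/q)}$. For $n\in\mathbb N=\{1,2,\dots\}$ let $f_n:[0,1]\to\mathbb R$ be the $n$-th $q$-sine function, that is, the eigenfunction of $$-\big(u'|u'|^{q-2}\big)'=(q-1)\,\lambda\, u|u|^{q-2}\ \text{ on }[0,1],\qquad u(0)=u(1)=0,$$ for the eigenvalue $\lambda=(n\pi_q)^q$, normalized by $f_n'(0)=n\pi_q$. Let $\{f_n^*\}_{n\in\mathbb N}\subset L^2(0,1)$ be the dual system, $\langle f_m,f_n^*\rangle=\delta_{mn}$ for all $m,n\in\mathbb N$, where $\langle g,h\rangle=\int_0^1 g h\,\mathrm dx$. Put $e_1(x)=\sqrt2\sin(\pi x)$ and $\tau_q(j)=\sqrt2\int_0^1 f_1(x)\sin(j\pi x)\,\mathrm dx$. Then $\tau_q(1)\neq0$, and for every prime $j$ the $j$-th $q$-sine Fourier coefficient of $g=e_1$ is $$\langle e_1,f_j^*\rangle=-\,\tau_q(j)\,\tau_q(1)^{-2}.$$ -/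

import Mathlib

noncomputable section

/-- The number `π_q = 2π / (q sin(π/q))`. -/
def piQ (q : ℝ) : ℝ := 2 * Real.pi / (q * Real.sin (Real.pi / q))

/-- The signed power `z ↦ z |z|^(q-2)`; its value at `z = 0` is `0`. -/
def signedPow (q z : ℝ) : ℝ := z * |z| ^ (q - 2)

/-- `u` solves on `[0,1]` the `q`-Laplacian eigenvalue problem
`-(u'|u'|^(q-2))' = (q-1) lam u|u|^(q-2)`, `u(0) = u(1) = 0`.
The derivatives are those of functions on `[0,1]`, one-sided at the end points. This is the same as
asking the equation with `u'|u'|^(q-2)` in `H¹(0,1)`: such a function is continuous, so `u` is `C¹`,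
and then the right-hand side is continuous, so `u'|u'|^(q-2)` is `C¹`. -/
structure IsQLaplaceSolution (q lam : ℝ) (u : ℝ → ℝ) : Prop where
  differentiableOn : DifferentiableOn ℝ u (Set.Icc 0 1)
  equation : ∀ x ∈ Set.Icc (0 : ℝ) 1,
    HasDerivWithinAt (fun y => signedPow q (derivWithin u (Set.Icc 0 1) y))
      (-((q - 1) * lam * signedPow q (u x))) (Set.Icc 0 1) x
  left_zero : u 0 = 0
  right_zero : u 1 = 0

/-- `u` is (on `[0,1]`) the `n`-th `q`-sine function `f_n`: the eigenfunction for the eigenvalue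
`(n π_q)^q`, normalized by `f_n'(0) = n π_q`. -/
structure IsQSine (q : ℝ) (n : ℕ) (u : ℝ → ℝ) : Prop where
  solution : IsQLaplaceSolution q ((n * piQ q) ^ q) u
  deriv_zero : derivWithin u (Set.Icc 0 1) 0 = n * piQ q

/-- The inner product of the real space `L²(0,1)`. -/
def innerL2 (g h : ℝ → ℝ) : ℝ := ∫ x in Set.Ioo (0 : ℝ) 1, g x * h x

/-- The orthonormal sine basis `e_n(x) = √2 sin(nπx)`, `n ≥ 1`. -/
def sineBasis (n : ℕ) (x : ℝ) : ℝ := Real.sqrt 2 * Real.sin (n * Real.pi * x)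

/-- The `j`-th sine Fourier coefficient `√2 ∫₀¹ g(x) sin(jπx) dx`. -/
def sineCoeff (g : ℝ → ℝ) (j : ℕ) : ℝ :=
  Real.sqrt 2 * ∫ x in Set.Ioo (0 : ℝ) 1, g x * Real.sin (j * Real.pi * x)

/-- `fd` is dual to `f` in `L²(0,1)` (indices from `1` on): every `fd n` is in `L²(0,1)`, and
`⟨f_m, fd_n⟩` is `1` for `m = n` and `0` otherwise. -/
structure IsDualFamily (f fd : ℕ → ℝ → ℝ) : Prop where
  memLp : ∀ n, 1 ≤ n →
    MeasureTheory.MemLp (fd n) 2 (MeasureTheory.volume.restrict (Set.Ioo (0 : ℝ) 1))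
  inner_eq : ∀ m n, 1 ≤ m → 1 ≤ n → innerL2 (f m) (fd n) = if m = n then 1 else 0

end

open MeasureTheory Set Filter Topology

/-! Write `τ k` for the sine coefficients of `f 1`. Every `f m` is `f 1` extended oddly and
periodically and then compressed by `m`, so `f m = ∑ₖ τ k e_{mk}`. Pairing with `fd j` shows that `d
l = ⟨e_l, fd j⟩` solves the dilation system `∑ₖ τ k d (m k) = δ_{mj}`, `m ≥ 1`. For prime `j` the
sequence with values `-τ j / τ 1 ^ 2` at `1`, `1 / τ 1` at `j` and `0` elsewhere solves it too
(`hasSum_dilation_of_prime`). Bounded solutions are unique as soon as `∑_{k ≥ 2} |τ k| < τ 1`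
(`eq_zero_of_hasSum_dilation`), and `d 1` is the claim.

The analytic core is this domination, which is where `q ≥ 12/11` is needed here. Even coefficients
vanish. With `E = ∫ (f 1)'^2`, Bessel's inequality for `(f 1)'` and Cauchy–Schwarz against `∑ 1 / k
^ 2` over odd `k ≥ 3` reduce it to `E (π² - 8) < π⁴ (τ 1)²` (`IsQSine.energy_lt`). A pointwise bound
on the velocity controls `E`; comparison of `f 1` with a multiple of `sin (π x)` bounds `τ 1` from
below.

All facts on the `q`-sines come from the phase `arcsinQ q (u x)`, which by conservation of energy is
piecewise linear with slope `± n π_q`. This identifies solutions although the signed powers need not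
be Lipschitz. -/

/-! ### Signed powers. -/

theorem signedPow_zero (q : ℝ) : signedPow q 0 = 0 := by simp [signedPow]

theorem signedPow_neg (q z : ℝ) : signedPow q (-z) = -signedPow q z := by
  simp [signedPow]

theorem signedPow_pos_iff {q z : ℝ} : 0 < signedPow q z ↔ 0 < z := by
  rcases eq_or_ne z 0 with rfl | hz
  · simp [signedPow]
  · exact mul_pos_iff_of_pos_right (Real.rpow_pos_of_pos (abs_pos.2 hz) _)

theorem abs_signedPow {q : ℝ} (hq : 1 < q) (z : ℝ) : |signedPow q z| = |z| ^ (q - 1) := by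
  rcases eq_or_ne z 0 with rfl | hz
  · rw [signedPow_zero, abs_zero, Real.zero_rpow (by linarith)]
  · have h := abs_pos.2 hz
    rw [signedPow, abs_mul, abs_of_pos (Real.rpow_pos_of_pos h _), ← Real.rpow_one_add' h.le]
    · ring_nf
    · linarith

theorem continuous_signedPow {q : ℝ} (hq : 1 < q) : Continuous (signedPow q) := by
  rw [continuous_iff_continuousAt]
  intro z
  rcases eq_or_ne z 0 with rfl | hz
  · rw [ContinuousAt, signedPow_zero, tendsto_zero_iff_abs_tendsto_zero]
    have h : Tendsto (fun z : ℝ => |z| ^ (q - 1)) (𝓝 0) (𝓝 (|0| ^ (q - 1))) :=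
      (continuous_abs.rpow_const fun _ => Or.inr (by linarith)).tendsto 0
    rw [abs_zero, Real.zero_rpow (by linarith)] at h
    exact h.congr fun z => (abs_signedPow hq z).symm
  · exact continuousAt_id.mul
      (continuous_abs.continuousAt.rpow_const (Or.inl (abs_ne_zero.2 hz)))

/-- The signed powers of conjugate exponents are inverse to each other. -/
theorem signedPow_conj {q : ℝ} (hq : 1 < q) (z : ℝ) :
    signedPow (q / (q - 1)) (signedPow q z) = z := by
  rcases eq_or_ne z 0 with rfl | hz
  · simp [signedPow_zero]
  · have h := abs_pos.2 hz
    have h1 : q - 1 ≠ 0 := by linarith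
    rw [signedPow, abs_signedPow hq, signedPow, mul_assoc, ← Real.rpow_mul h.le,
      ← Real.rpow_add h]
    have : q - 2 + (q - 1) * (q / (q - 1) - 2) = 0 := by field_simp; ring
    rw [this, Real.rpow_zero, mul_one]

theorem abs_signedPow_rpow_conj {q : ℝ} (hq : 1 < q) (z : ℝ) :
    |signedPow q z| ^ (q / (q - 1)) = |z| ^ q := by
  have h1 : q - 1 ≠ 0 := by linarith
  rw [abs_signedPow hq, ← Real.rpow_mul (abs_nonneg z)]
  congr 1
  field_simp

theorem hasDerivAt_abs_rpow_signedPow {q : ℝ} (hq : 1 < q) (z : ℝ) :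
    HasDerivAt (fun z : ℝ => |z| ^ q) (q * signedPow q z) z := by
  convert hasDerivAt_abs_rpow z hq using 1
  rw [signedPow]; ring

theorem one_lt_conj {q : ℝ} (hq : 1 < q) : 1 < q / (q - 1) := by
  rw [lt_div_iff₀ (by linarith)]; linarith

theorem piQ_pos {q : ℝ} (hq : 1 < q) : 0 < piQ q := by
  have h0 : 0 < q := by linarith
  refine div_pos (by positivity) (mul_pos h0 (Real.sin_pos_of_pos_of_lt_pi (by positivity) ?_))
  rw [div_lt_iff₀ h0]
  nlinarith [Real.pi_pos]

/-! ### Conservation of energy. -/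

/-- A trajectory on `[0,1]` of the system `u' = v`, `(v|v|^(q-2))' = -(q-1) ν^q u|u|^(q-2)`
at the energy level `|v|^q + ν^q |u|^q = ν^q`. -/
structure IsQFlow (q ν : ℝ) (u v : ℝ → ℝ) : Prop where
  continuousOn_vel : ContinuousOn v (Icc 0 1)
  hasDeriv : ∀ x ∈ Icc (0 : ℝ) 1, HasDerivWithinAt u (v x) (Icc 0 1) x
  hasDeriv_momentum : ∀ x ∈ Icc (0 : ℝ) 1,
    HasDerivWithinAt (fun y => signedPow q (v y)) (-((q - 1) * ν ^ q * signedPow q (u x)))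
      (Icc 0 1) x
  energy : ∀ x ∈ Icc (0 : ℝ) 1, |v x| ^ q = ν ^ q * (1 - |u x| ^ q)

theorem IsQFlow.neg {q ν : ℝ} {u v : ℝ → ℝ} (h : IsQFlow q ν u v) :
    IsQFlow q ν (fun x => -u x) (fun x => -v x) where
  continuousOn_vel := h.continuousOn_vel.neg
  hasDeriv x hx := (h.hasDeriv x hx).neg
  hasDeriv_momentum x hx := by
    simp only [signedPow_neg, mul_neg]
    exact (h.hasDeriv_momentum x hx).neg
  energy x hx := by simpa only [abs_neg] using h.energy x hx

theorem IsQFlow.continuousOn {q ν : ℝ} {u v : ℝ → ℝ} (h : IsQFlow q ν u v) :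
    ContinuousOn u (Icc 0 1) := fun x hx => (h.hasDeriv x hx).continuousWithinAt

theorem IsQFlow.abs_le_one {q ν : ℝ} {u v : ℝ → ℝ} (h : IsQFlow q ν u v) (hq : 1 < q)
    (hν : 0 < ν) {x : ℝ} (hx : x ∈ Icc (0 : ℝ) 1) : |u x| ≤ 1 := by
  have h1 : 0 ≤ ν ^ q * (1 - |u x| ^ q) :=
    h.energy x hx ▸ Real.rpow_nonneg (abs_nonneg _) _
  have h2 : |u x| ^ q ≤ 1 := by
    have := nonneg_of_mul_nonneg_right h1 (Real.rpow_pos_of_pos hν q)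
    linarith
  by_contra! h3
  exact (Real.one_lt_rpow h3 (by linarith)).not_ge h2

theorem IsQFlow.abs_vel {q ν : ℝ} {u v : ℝ → ℝ} (h : IsQFlow q ν u v) (hq : 1 < q)
    (hν : 0 < ν) {x : ℝ} (hx : x ∈ Icc (0 : ℝ) 1) :
    |v x| = ν * (1 - |u x| ^ q) ^ (1 / q) := by
  have h0 : q ≠ 0 := by linarith
  have h2 : |u x| ^ q ≤ 1 :=
    Real.rpow_le_one (abs_nonneg _) (h.abs_le_one hq hν hx) (by linarith)
  have h3 : (|v x| ^ q) ^ (1 / q) = (ν ^ q * (1 - |u x| ^ q)) ^ (1 / q) := by rw [h.energy x hx]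
  rwa [← Real.rpow_mul (abs_nonneg _), mul_one_div_cancel h0, Real.rpow_one,
    Real.mul_rpow (by positivity) (by linarith), ← Real.rpow_mul hν.le, mul_one_div_cancel h0,
    Real.rpow_one] at h3

theorem IsQSine.isQFlow {q : ℝ} (hq : 1 < q) {n : ℕ} {u : ℝ → ℝ} (h : IsQSine q n u) :
    IsQFlow q (n * piQ q) u (derivWithin u (Icc 0 1)) := by
  set v := derivWithin u (Icc 0 1) with hv
  set lam := (n * piQ q) ^ q with hlam
  have hu : ∀ x ∈ Icc (0 : ℝ) 1, HasDerivWithinAt u (v x) (Icc 0 1) x := fun x hx =>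
    (h.solution.differentiableOn x hx).hasDerivWithinAt
  have hw := h.solution.equation
  rw [← hv] at hw
  have hq' := one_lt_conj hq
  have h1 : q - 1 ≠ 0 := by linarith
  have hν : 0 ≤ n * piQ q := mul_nonneg n.cast_nonneg (piQ_pos hq).le
  refine ⟨?_, hu, hw, ?_⟩
  · have hc : ContinuousOn (fun y => signedPow q (v y)) (Icc 0 1) :=
      fun x hx => (hw x hx).continuousWithinAt
    exact ((continuous_signedPow hq').comp_continuousOn hc).congr
      fun x _ => (signedPow_conj hq (v x)).symm
  -- The equation differentiates the momentum, not the velocity, so the kinetic term `|v|^q` is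
  -- written as the conjugate power of the momentum.
  · set H : ℝ → ℝ := fun x => |signedPow q (v x)| ^ (q / (q - 1)) + lam * |u x| ^ q with hH
    have hd : ∀ x ∈ Icc (0 : ℝ) 1, HasDerivWithinAt H 0 (Icc 0 1) x := by
      intro x hx
      have a1 := (hasDerivAt_abs_rpow_signedPow hq' (signedPow q (v x))).comp_hasDerivWithinAt x
        (hw x hx)
      have a2 := ((hasDerivAt_abs_rpow_signedPow hq (u x)).comp_hasDerivWithinAt x
        (hu x hx)).const_mul lam
      refine (a1.add a2).congr_deriv ?_
      rw [signedPow_conj hq]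
      field_simp
      ring
    have hconst : ∀ x ∈ Icc (0 : ℝ) 1, H x = H 0 := by
      refine constant_of_derivWithin_zero (fun x hx => (hd x hx).differentiableWithinAt) ?_
      intro x hx
      exact (hd x (Ico_subset_Icc_self hx)).derivWithin
        (uniqueDiffOn_Icc_zero_one x (Ico_subset_Icc_self hx))
    intro x hx
    have := hconst x hx
    simp only [hH, abs_signedPow_rpow_conj hq] at this
    rw [h.solution.left_zero, abs_zero, Real.zero_rpow (by linarith), hv, h.deriv_zero,
      abs_of_nonneg hν, ← hv] at this
    linarith

/-! ### The generalized arcsine. -/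

theorem integral_betaPDFReal {α β : ℝ} (hα : 0 < α) (hβ : 0 < β) :
    ∫ x, ProbabilityTheory.betaPDFReal α β x = 1 := by
  have h := ProbabilityTheory.lintegral_betaPDF_eq_one hα hβ
  rw [integral_eq_lintegral_of_nonneg_ae]
  · simpa [ProbabilityTheory.betaPDF] using congrArg ENNReal.toReal h
  · refine Eventually.of_forall fun x => ?_
    by_cases hx : 0 < x ∧ x < 1
    · exact (ProbabilityTheory.betaPDFReal_pos hx.1 hx.2 hα hβ).le
    · simp [ProbabilityTheory.betaPDFReal, hx]
  · exact (ProbabilityTheory.measurable_betaPDFReal α β).aestronglyMeasurable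

/-- The derivative `(1 - |t|^q)^(-1/q)` of the generalized arcsine. -/
noncomputable def arcsinQKernel (q t : ℝ) : ℝ := (1 - |t| ^ q) ^ (-(1 / q))

/-- The generalized arcsine `∫₀^y (1 - |t|^q)^(-1/q) dt`. -/
noncomputable def arcsinQ (q y : ℝ) : ℝ := ∫ t in (0 : ℝ)..y, arcsinQKernel q t

/-- The substitution `x ↦ x ^ q` turns the beta density with parameters `1/q`, `1 - 1/q` into a
multiple of the kernel; the reflection formula for `Γ` evaluates the constant. -/
theorem integral_arcsinQKernel {q : ℝ} (hq : 1 < q) :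
    ∫ t in Ioo (0 : ℝ) 1, arcsinQKernel q t = piQ q / 2 := by
  have h0 : 0 < q := by linarith
  have hα : 0 < 1 / q := by positivity
  have hα1 : 1 / q < 1 := by rw [div_lt_one h0]; exact hq
  have hβ : 0 < 1 - 1 / q := by linarith
  set B := ProbabilityTheory.beta (1 / q) (1 - 1 / q) with hB
  have hBval : B = Real.pi / Real.sin (Real.pi * (1 / q)) := by
    rw [hB, ProbabilityTheory.beta, Real.Gamma_mul_Gamma_one_sub, add_sub_cancel, Real.Gamma_one,
      div_one]
  have hBpos : 0 < B := ProbabilityTheory.beta_pos hα hβ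
  have h1 : ∫ x in Ioi (0 : ℝ), ProbabilityTheory.betaPDFReal (1 / q) (1 - 1 / q) x = 1 := by
    rw [setIntegral_eq_integral_of_forall_compl_eq_zero, integral_betaPDFReal hα hβ]
    intro x hx
    have : ¬ (0 < x ∧ x < 1) := fun h => hx h.1
    simp [ProbabilityTheory.betaPDFReal, this]
  rw [← integral_comp_rpow_Ioi _ h0.ne'] at h1
  have h2 : ∫ x in Ioi (0 : ℝ), (|q| * x ^ (q - 1)) •
      ProbabilityTheory.betaPDFReal (1 / q) (1 - 1 / q) (x ^ q) =
      ∫ x in Ioi (0 : ℝ), (Ioo (0 : ℝ) 1).indicator (fun x => q / B * arcsinQKernel q x) x := by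
    refine setIntegral_congr_fun measurableSet_Ioi fun x hx => ?_
    have hx0 : (0 : ℝ) < x := hx
    by_cases hx1 : x < 1
    · have hm : x ∈ Ioo (0 : ℝ) 1 := ⟨hx0, hx1⟩
      have hc : 0 < x ^ q ∧ x ^ q < 1 := ⟨Real.rpow_pos_of_pos hx0 q, Real.rpow_lt_one hx0.le hx1 h0⟩
      have e1 : (x ^ q) ^ (1 / q - 1) = (x ^ (q - 1))⁻¹ := by
        rw [← Real.rpow_mul hx0.le, ← Real.rpow_neg hx0.le]
        congr 1
        field_simp
        ring
      have hp : x ^ (q - 1) ≠ 0 := (Real.rpow_pos_of_pos hx0 _).ne'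
      simp only [indicator_of_mem hm, ProbabilityTheory.betaPDFReal, if_pos hc, e1, arcsinQKernel,
        abs_of_pos hx0, abs_of_pos h0, smul_eq_mul, ← hB]
      rw [show (1 - 1 / q - 1) = -(1 / q) by ring]
      field_simp
    · have hm : x ∉ Ioo (0 : ℝ) 1 := fun h => hx1 h.2
      have hc : ¬ (0 < x ^ q ∧ x ^ q < 1) := fun h =>
        h.2.not_ge (Real.one_le_rpow (not_lt.1 hx1) h0.le)
      simp only [indicator_of_notMem hm, ProbabilityTheory.betaPDFReal, if_neg hc, smul_zero]
  rw [h2, setIntegral_indicator measurableSet_Ioo,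
    inter_eq_self_of_subset_right Ioo_subset_Ioi_self, integral_const_mul] at h1
  have h3 : ∫ t in Ioo (0 : ℝ) 1, arcsinQKernel q t = B / q := by
    field_simp at h1 ⊢
    linarith
  rw [h3, hBval, piQ]
  have : 0 < Real.sin (Real.pi * (1 / q)) := by
    by_contra! hs
    have := div_nonpos_of_nonneg_of_nonpos Real.pi_pos.le hs
    linarith
  rw [show Real.pi / q = Real.pi * (1 / q) by ring]
  field_simp

theorem arcsinQKernel_neg (q t : ℝ) : arcsinQKernel q (-t) = arcsinQKernel q t := by
  simp [arcsinQKernel]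

theorem one_sub_abs_rpow_pos {q t : ℝ} (hq : 1 < q) (ht : |t| < 1) : 0 < 1 - |t| ^ q := by
  linarith [Real.rpow_lt_one (abs_nonneg t) ht (by linarith : 0 < q)]

theorem arcsinQKernel_pos {q t : ℝ} (hq : 1 < q) (ht : |t| < 1) : 0 < arcsinQKernel q t :=
  Real.rpow_pos_of_pos (one_sub_abs_rpow_pos hq ht) _

theorem continuousAt_arcsinQKernel {q t : ℝ} (hq : 1 < q) (ht : |t| < 1) :
    ContinuousAt (arcsinQKernel q) t := by
  refine ContinuousAt.rpow_const ?_ (Or.inl (one_sub_abs_rpow_pos hq ht).ne')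
  exact continuousAt_const.sub
    (continuous_abs.continuousAt.rpow_const (Or.inr (by linarith)))

theorem measurable_arcsinQKernel (q : ℝ) : Measurable (arcsinQKernel q) := by
  unfold arcsinQKernel
  fun_prop

theorem intervalIntegrable_arcsinQKernel {q : ℝ} (hq : 1 < q) :
    IntervalIntegrable (arcsinQKernel q) volume (-1) 1 := by
  have h : IntervalIntegrable (arcsinQKernel q) volume 0 1 := by
    rw [intervalIntegrable_iff_integrableOn_Ioo_of_le zero_le_one]
    -- A non-integrable function has integral `0` by convention, so the nonzero value already proves
    -- integrability.
    refine Integrable.of_integral_ne_zero ?_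
    rw [integral_arcsinQKernel hq]
    exact (half_pos (piQ_pos hq)).ne'
  refine IntervalIntegrable.trans ?_ h
  rw [IntervalIntegrable.iff_comp_neg]
  simpa [arcsinQKernel_neg] using h.symm

theorem arcsinQ_zero (q : ℝ) : arcsinQ q 0 = 0 := by simp [arcsinQ]

theorem arcsinQ_neg (q y : ℝ) : arcsinQ q (-y) = -arcsinQ q y := by
  rw [arcsinQ, arcsinQ, intervalIntegral.integral_symm]
  have := intervalIntegral.integral_comp_neg (a := 0) (b := y) (arcsinQKernel q)
  simp only [arcsinQKernel_neg, neg_zero] at this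
  rw [this]

theorem arcsinQ_one {q : ℝ} (hq : 1 < q) : arcsinQ q 1 = piQ q / 2 := by
  rw [arcsinQ, intervalIntegral.integral_of_le zero_le_one, integral_Ioc_eq_integral_Ioo,
    integral_arcsinQKernel hq]

theorem continuousOn_arcsinQ {q : ℝ} (hq : 1 < q) : ContinuousOn (arcsinQ q) (Icc (-1) 1) := by
  have := intervalIntegral.continuousOn_primitive_interval'
    (intervalIntegrable_arcsinQKernel hq) (a := 0) (by rw [uIcc_of_le] <;> norm_num)
  rwa [uIcc_of_le (by norm_num)] at this

theorem hasDerivAt_arcsinQ {q y : ℝ} (hq : 1 < q) (hy : |y| < 1) :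
    HasDerivAt (arcsinQ q) (arcsinQKernel q y) y := by
  refine intervalIntegral.integral_hasDerivAt_right ?_
    (measurable_arcsinQKernel q).stronglyMeasurable.stronglyMeasurableAtFilter
    (continuousAt_arcsinQKernel hq hy)
  refine (intervalIntegrable_arcsinQKernel hq).mono_set ?_
  rw [abs_lt] at hy
  rw [uIcc_of_le (by norm_num : (-1 : ℝ) ≤ 1)]
  refine uIcc_subset_Icc (by norm_num) ⟨hy.1.le, hy.2.le⟩

theorem strictMonoOn_arcsinQ {q : ℝ} (hq : 1 < q) : StrictMonoOn (arcsinQ q) (Icc (-1) 1) := by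
  refine strictMonoOn_of_deriv_pos (convex_Icc _ _) (continuousOn_arcsinQ hq) fun y hy => ?_
  rw [interior_Icc] at hy
  have : |y| < 1 := abs_lt.2 hy
  rw [(hasDerivAt_arcsinQ hq this).deriv]
  exact arcsinQKernel_pos hq this

theorem arcsinQ_inj {q y z : ℝ} (hq : 1 < q) (hy : |y| ≤ 1) (hz : |z| ≤ 1)
    (h : arcsinQ q y = arcsinQ q z) : y = z :=
  (strictMonoOn_arcsinQ hq).injOn (abs_le.1 hy) (abs_le.1 hz) h

/-! ### Phase of a trajectory and its turning points. -/

namespace IsQFlow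

variable {q ν : ℝ} {u v : ℝ → ℝ}

theorem abs_eq_one_of_vel_eq_zero (h : IsQFlow q ν u v) (hq : 1 < q) (hν : 0 < ν) {x : ℝ}
    (hx : x ∈ Icc (0 : ℝ) 1) (hv : v x = 0) : |u x| = 1 := by
  have h1 := h.energy x hx
  rw [hv, abs_zero, Real.zero_rpow (by linarith), eq_comm, mul_eq_zero] at h1
  have h2 : |u x| ^ q = 1 := by
    rcases h1 with h1 | h1
    · exact absurd h1 (Real.rpow_pos_of_pos hν q).ne'
    · linarith
  by_contra h3
  rcases lt_or_gt_of_ne h3 with h3 | h3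
  · exact (Real.rpow_lt_one (abs_nonneg _) h3 (by linarith)).ne h2
  · exact (Real.one_lt_rpow h3 (by linarith)).ne' h2

theorem vel_eq_zero (h : IsQFlow q ν u v) (hq : 1 < q) (hν : 0 < ν) {x : ℝ}
    (hx : x ∈ Icc (0 : ℝ) 1) (hu : |u x| = 1) : v x = 0 := by
  have h1 := h.abs_vel hq hν hx
  rwa [hu, Real.one_rpow, sub_self, Real.zero_rpow (one_div_pos.2 (by linarith)).ne', mul_zero,
    abs_eq_zero] at h1

theorem hasDerivAt (h : IsQFlow q ν u v) {x : ℝ} (hx : x ∈ Ioo (0 : ℝ) 1) :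
    HasDerivAt u (v x) x :=
  (h.hasDeriv x (Ioo_subset_Icc_self hx)).hasDerivAt (Icc_mem_nhds hx.1 hx.2)

theorem continuousOn_arcsinQ_comp (h : IsQFlow q ν u v) (hq : 1 < q) (hν : 0 < ν) :
    ContinuousOn (fun x => arcsinQ q (u x)) (Icc 0 1) :=
  (continuousOn_arcsinQ hq).comp h.continuousOn fun _ hx => abs_le.1 (h.abs_le_one hq hν hx)

/-- As long as the velocity is positive, the phase grows at the constant rate `ν`. -/
theorem arcsinQ_eq_of_vel_pos (h : IsQFlow q ν u v) (hq : 1 < q) (hν : 0 < ν) {α x : ℝ}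
    (hα : 0 ≤ α) (hαx : α < x) (hx : x ≤ 1) (hv : ∀ y ∈ Ioo α x, 0 < v y) :
    arcsinQ q (u x) = arcsinQ q (u α) + ν * (x - α) := by
  have hd : ∀ y ∈ Ioo α x, HasDerivAt (fun x => arcsinQ q (u x)) ν y := by
    intro y hy
    have hy' : y ∈ Ioo (0 : ℝ) 1 := ⟨hα.trans_lt hy.1, hy.2.trans_le hx⟩
    have hyI := Ioo_subset_Icc_self hy'
    have hu1 : |u y| < 1 := (h.abs_le_one hq hν hyI).lt_of_ne fun h1 =>
      (hv y hy).ne' (h.vel_eq_zero hq hν hyI h1)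
    have hvel := h.abs_vel hq hν hyI
    rw [abs_of_pos (hv y hy)] at hvel
    refine ((hasDerivAt_arcsinQ hq hu1).comp y (h.hasDerivAt hy')).congr_deriv ?_
    rw [hvel, arcsinQKernel, Real.rpow_neg (one_sub_abs_rpow_pos hq hu1).le]
    have := (Real.rpow_pos_of_pos (one_sub_abs_rpow_pos hq hu1) (1 / q)).ne'
    field_simp
  obtain ⟨c, -, hc⟩ := exists_hasDerivAt_eq_slope (fun x => arcsinQ q (u x)) (fun _ => ν) hαx
    ((h.continuousOn_arcsinQ_comp hq hν).mono (Icc_subset_Icc hα hx)) hd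
  rw [eq_div_iff (by linarith)] at hc
  linarith

/-- A positive velocity cannot vanish too early: at its first zero `|u| = 1`, so the phase is `± π_q
/ 2`, yet by then it has risen strictly above its starting value and is still strictly below `π_q /
2`. -/
theorem arcsinQ_eq_of_eventually_vel_pos (h : IsQFlow q ν u v) (hq : 1 < q) (hν : 0 < ν)
    {α x : ℝ} (hα : 0 ≤ α) (hαx : α ≤ x) (hx : x ≤ 1) (hv : ∀ᶠ y in 𝓝[>] α, 0 < v y)
    (hle : arcsinQ q (u α) + ν * (x - α) ≤ piQ q / 2) :
    arcsinQ q (u x) = arcsinQ q (u α) + ν * (x - α) := by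
  rcases hαx.eq_or_lt with rfl | hαx
  · simp
  refine h.arcsinQ_eq_of_vel_pos hq hν hα hαx hx ?_
  by_contra! hcon
  obtain ⟨y, hy, hvy⟩ := hcon
  obtain ⟨ε, hε, hεv⟩ := mem_nhdsGT_iff_exists_Ioo_subset.1 hv
  have hε : α < ε := hε
  have hεy : ε ≤ y := by
    by_contra! hlt
    exact (show 0 < v y from hεv ⟨hy.1, hlt⟩).not_ge hvy
  -- The search for the first zero starts to the right of `α`, since `v α = 0` at a turning point.
  set β := (α + ε) / 2 with hβ
  have hvβ : 0 < v β := hεv ⟨by linarith, by linarith⟩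
  set Z := Icc β y ∩ v ⁻¹' Iic 0 with hZ
  have hsub : Icc β y ⊆ Icc 0 1 := Icc_subset_Icc (by linarith) (hy.2.le.trans hx)
  have hZc : IsClosed Z :=
    (h.continuousOn_vel.mono hsub).preimage_isClosed_of_isClosed isClosed_Icc isClosed_Iic
  have hZb : BddBelow Z := ⟨β, fun z hz => hz.1.1⟩
  have hZm : sInf Z ∈ Z := hZc.csInf_mem ⟨y, ⟨by linarith, le_rfl⟩, hvy⟩ hZb
  set y₀ := sInf Z with hy₀
  have hvy₀ : v y₀ = 0 := by
    have hc := h.continuousOn_vel.mono ((Icc_subset_Icc_right hZm.1.2).trans hsub)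
    obtain ⟨z, hz, hvz⟩ := intermediate_value_Icc' hZm.1.1 hc ⟨hZm.2, hvβ.le⟩
    have : y₀ ≤ z := csInf_le hZb ⟨⟨hz.1, hz.2.trans hZm.1.2⟩, hvz.le⟩
    rwa [le_antisymm this hz.2]
  have hαy₀ : α < y₀ := by linarith [hZm.1.1]
  have hpos : ∀ z ∈ Ioo α y₀, 0 < v z := by
    intro z hz
    rcases lt_or_ge z ε with hzε | hzε
    · exact hεv ⟨hz.1, hzε⟩
    · by_contra! hvz
      exact hz.2.not_ge (csInf_le hZb ⟨⟨by linarith, hz.2.le.trans hZm.1.2⟩, hvz⟩)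
  have hphase := h.arcsinQ_eq_of_vel_pos hq hν hα hαy₀ (hsub hZm.1).2 hpos
  have hαI : α ∈ Icc (0 : ℝ) 1 := ⟨hα, by linarith⟩
  have hlt1 : ν * (y₀ - α) < ν * (x - α) :=
    mul_lt_mul_of_pos_left (by linarith [hZm.1.2, hy.2]) hν
  have hlt2 : 0 < ν * (y₀ - α) := mul_pos hν (by linarith)
  have hlow : -(piQ q / 2) ≤ arcsinQ q (u α) := by
    rw [← arcsinQ_one hq, ← arcsinQ_neg]
    have := abs_le.1 (h.abs_le_one hq hν hαI)
    exact (strictMonoOn_arcsinQ hq).monotoneOn (by norm_num) this this.1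
  rcases eq_or_eq_neg_of_abs_eq (h.abs_eq_one_of_vel_eq_zero hq hν (hsub hZm.1) hvy₀) with h1 | h1
  · rw [h1, arcsinQ_one hq] at hphase
    linarith
  · rw [h1, arcsinQ_neg, arcsinQ_one hq] at hphase
    linarith

/-- The energy identity alone would allow the trajectory to rest at `-1`. The momentum equation
forbids it: there the momentum is `0` with derivative `(q - 1) ν^q > 0`. -/
theorem eventually_vel_pos_of_eq_neg_one (h : IsQFlow q ν u v) (hq : 1 < q) (hν : 0 < ν)
    {α : ℝ} (hα : 0 ≤ α) (hα1 : α < 1) (hu : u α = -1) : ∀ᶠ y in 𝓝[>] α, 0 < v y := by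
  have hαI : α ∈ Icc (0 : ℝ) 1 := ⟨hα, hα1.le⟩
  have hv : v α = 0 := h.vel_eq_zero hq hν hαI (by rw [hu]; simp)
  have hd := hasDerivWithinAt_iff_tendsto_slope.1 (h.hasDeriv_momentum α hαI)
  have hpos : 0 < -((q - 1) * ν ^ q * signedPow q (u α)) := by
    rw [hu, signedPow_neg]
    have h1 : signedPow q 1 = 1 := by simp [signedPow]
    rw [h1, mul_neg_one, neg_neg]
    exact mul_pos (by linarith) (Real.rpow_pos_of_pos hν q)
  have hle : 𝓝[>] α ≤ 𝓝[Icc 0 1 \ {α}] α := by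
    rw [← nhdsWithin_Ioo_eq_nhdsGT hα1]
    exact nhdsWithin_mono _ fun y hy => ⟨⟨hα.trans hy.1.le, hy.2.le⟩, hy.1.ne'⟩
  have hev := (hd.mono_left hle).eventually_const_lt hpos
  filter_upwards [hev, self_mem_nhdsWithin] with y hy hyα
  rw [slope_def_field, hv, signedPow_zero, sub_zero] at hy
  have hyα : α < y := hyα
  exact signedPow_pos_iff.1 ((div_pos_iff_of_pos_right (by linarith)).1 hy)

/-- The phase of the trajectory starting at the origin, on the `k`-th half period. -/
theorem arcsinQ_eq {n : ℕ} (hn : 1 ≤ n) (h : IsQFlow q (n * piQ q) u v) (hq : 1 < q)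
    (hu0 : u 0 = 0) (hv0 : v 0 = n * piQ q) (k : ℕ) :
    ∀ x ∈ Icc (0 : ℝ) 1, |n * x - k| ≤ 1 / 2 →
      arcsinQ q (u x) = (-1) ^ k * (piQ q * (n * x - k)) := by
  have hp := piQ_pos hq
  have hn0 : (0 : ℝ) < n := by exact_mod_cast hn
  have hν : 0 < n * piQ q := mul_pos hn0 hp
  induction k with
  | zero =>
    intro x hx hk
    simp only [Nat.cast_zero, sub_zero] at hk ⊢
    have hev : ∀ᶠ y in 𝓝[>] (0 : ℝ), 0 < v y := by
      have h1 : Tendsto v (𝓝[>] 0) (𝓝 (v 0)) := by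
        refine (h.continuousOn_vel 0 (by norm_num)).mono_left ?_
        rw [← nhdsWithin_Ioo_eq_nhdsGT (zero_lt_one' ℝ)]
        exact nhdsWithin_mono _ Ioo_subset_Icc_self
      exact h1.eventually_const_lt (by rwa [hv0])
    have := h.arcsinQ_eq_of_eventually_vel_pos hq hν le_rfl hx.1 hx.2 hev (by
      rw [hu0, arcsinQ_zero]
      nlinarith [(abs_le.1 hk).2])
    rw [this, hu0, arcsinQ_zero]
    ring
  | succ k ih =>
    intro x hx hk
    push_cast at hk ⊢
    obtain ⟨hk1, hk2⟩ := abs_le.1 hk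
    -- The turning point between the half periods `k` and `k + 1`, where the phase is `(-1)^k π_q /
    -- 2`.
    set α := (k + 1 / 2) / (n : ℝ) with hα
    have hnα : n * α = k + 1 / 2 := by rw [hα]; field_simp
    have hα0 : 0 ≤ α := by positivity
    have hαx : α ≤ x := by
      rw [hα, div_le_iff₀ hn0]; linarith
    have hαI : α ∈ Icc (0 : ℝ) 1 := ⟨hα0, hαx.trans hx.2⟩
    have hphase := ih α hαI (by rw [hnα, add_sub_cancel_left]; norm_num)
    rw [hnα, add_sub_cancel_left] at hphase
    rcases hαx.eq_or_lt with hαx' | hαx'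
    · rw [← hαx', hphase, hnα, pow_succ]
      ring
    have hα1 : α < 1 := hαx'.trans_le hx.2
    rcases neg_one_pow_eq_or ℝ k with hs | hs
    · have huα : u α = 1 := by
        refine arcsinQ_inj hq (h.abs_le_one hq hν hαI) (by simp) ?_
        rw [hphase, arcsinQ_one hq, hs]
        ring
      -- At a maximum the reflected trajectory `-u` leaves `-1` with positive velocity.
      have hev := h.neg.eventually_vel_pos_of_eq_neg_one hq hν hα0 hα1 (by rw [huα])
      have := h.neg.arcsinQ_eq_of_eventually_vel_pos hq hν hα0 hαx hx.2 hev (by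
        rw [huα, arcsinQ_neg, arcsinQ_one hq]
        nlinarith)
      rw [arcsinQ_neg, huα, arcsinQ_neg, arcsinQ_one hq] at this
      rw [pow_succ, hs]
      linear_combination -this + piQ q * hnα
    · have huα : u α = -1 := by
        refine arcsinQ_inj hq (h.abs_le_one hq hν hαI) (by simp) ?_
        rw [hphase, arcsinQ_neg, arcsinQ_one hq, hs]
        ring
      have hev := h.eventually_vel_pos_of_eq_neg_one hq hν hα0 hα1 huα
      have := h.arcsinQ_eq_of_eventually_vel_pos hq hν hα0 hαx hx.2 hev (by
        rw [huα, arcsinQ_neg, arcsinQ_one hq]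
        nlinarith)
      rw [huα, arcsinQ_neg, arcsinQ_one hq] at this
      rw [pow_succ, hs]
      linear_combination this - piQ q * hnα

end IsQFlow

/-! ### Periodicity and symmetry of the `q`-sine functions. -/

theorem IsQSine.arcsinQ_eq {q : ℝ} (hq : 1 < q) {n : ℕ} (hn : 1 ≤ n) {u : ℝ → ℝ}
    (h : IsQSine q n u) (k : ℕ) {x : ℝ} (hx : x ∈ Icc (0 : ℝ) 1) (hk : |n * x - k| ≤ 1 / 2) :
    arcsinQ q (u x) = (-1) ^ k * (piQ q * (n * x - k)) :=
  (h.isQFlow hq).arcsinQ_eq hn hq h.solution.left_zero h.deriv_zero k x hx hk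

theorem IsQSine.abs_le_one {q : ℝ} (hq : 1 < q) {n : ℕ} (hn : 1 ≤ n) {u : ℝ → ℝ}
    (h : IsQSine q n u) {x : ℝ} (hx : x ∈ Icc (0 : ℝ) 1) : |u x| ≤ 1 :=
  (h.isQFlow hq).abs_le_one hq (mul_pos (by exact_mod_cast hn) (piQ_pos hq)) hx

/-- Every `q`-sine function is a rescaled periodic extension of the first one. -/
theorem IsQSine.eq_of_abs_sub_le {q : ℝ} (hq : 1 < q) {n : ℕ} (hn : 1 ≤ n) {F u : ℝ → ℝ}
    (hF : IsQSine q 1 F) (h : IsQSine q n u) (k : ℕ) {x : ℝ} (hx : x ∈ Icc (0 : ℝ) 1)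
    (hk : |n * x - k| ≤ 1 / 2) :
    u x = (-1) ^ k * (SignType.sign (n * x - k) * F |n * x - k|) := by
  set s := n * x - k with hs
  have hsI : |s| ∈ Icc (0 : ℝ) 1 := ⟨abs_nonneg s, by linarith⟩
  have hFs := hF.arcsinQ_eq hq le_rfl 0 hsI (by simpa using hk)
  simp only [pow_zero, Nat.cast_one, Nat.cast_zero, one_mul, sub_zero] at hFs
  have hux := h.arcsinQ_eq hq hn k hx hk
  rw [← hs] at hux
  have hb := hF.abs_le_one hq le_rfl hsI
  rcases lt_trichotomy s 0 with h0 | h0 | h0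
  · rw [abs_of_neg h0] at hFs hb ⊢
    simp only [sign_neg h0, SignType.coe_neg_one]
    rcases neg_one_pow_eq_or ℝ k with hk' | hk' <;> rw [hk'] at hux ⊢ <;>
    refine arcsinQ_inj hq (h.abs_le_one hq hn hx) (by simpa using hb) ?_ <;>
    simp only [one_mul, neg_mul, neg_neg, arcsinQ_neg] at hux ⊢ <;>
    linarith
  · have hF0 : F 0 = 0 := hF.solution.left_zero
    rw [h0, abs_zero, hF0, mul_zero, mul_zero]
    refine arcsinQ_inj hq (h.abs_le_one hq hn hx) (by simp) ?_
    rw [hux, h0, arcsinQ_zero]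
    ring
  · rw [abs_of_pos h0] at hFs hb ⊢
    simp only [sign_pos h0, SignType.coe_one]
    rcases neg_one_pow_eq_or ℝ k with hk' | hk' <;> rw [hk'] at hux ⊢ <;>
    refine arcsinQ_inj hq (h.abs_le_one hq hn hx) (by simpa using hb) ?_ <;>
    simp only [one_mul, neg_mul, neg_neg, arcsinQ_neg] at hux ⊢ <;>
    linarith

/-- For `y ≤ 1/2`, the half period `0` at `y` and the half period `1` at `1 - y` give the same phase
`π_q y`. -/
theorem IsQSine.symm {q : ℝ} (hq : 1 < q) {F : ℝ → ℝ} (hF : IsQSine q 1 F) {x : ℝ}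
    (hx : x ∈ Icc (0 : ℝ) 1) : F (1 - x) = F x := by
  have key : ∀ y ∈ Icc (0 : ℝ) (1 / 2), F (1 - y) = F y := by
    intro y hy
    have hyI : y ∈ Icc (0 : ℝ) 1 := ⟨hy.1, by linarith [hy.2]⟩
    have hyI' : 1 - y ∈ Icc (0 : ℝ) 1 := ⟨by linarith [hy.2], by linarith [hy.1]⟩
    refine arcsinQ_inj hq (hF.abs_le_one hq le_rfl hyI') (hF.abs_le_one hq le_rfl hyI) ?_
    rw [hF.arcsinQ_eq hq le_rfl 0 hyI (by rw [abs_le]; norm_num; constructor <;> linarith [hy.1, hy.2]),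
      hF.arcsinQ_eq hq le_rfl 1 hyI' (by rw [abs_le]; norm_num; constructor <;> linarith [hy.1, hy.2])]
    push_cast
    ring
  rcases le_total x (1 / 2) with h | h
  · exact key x ⟨hx.1, h⟩
  · have := key (1 - x) ⟨by linarith [hx.2], by linarith⟩
    rw [sub_sub_cancel] at this
    exact this.symm

/-! ### Elementary inequalities. -/

/-- From `ζ(2) = π²/6` remove the even terms, a quarter of the total, and the term `k = 1`. -/
theorem sum_inv_sq_odd_le (s : Finset ℕ) (hs : ∀ k ∈ s, 2 ≤ k ∧ Odd k) :
    ∑ k ∈ s, 1 / (k : ℝ) ^ 2 ≤ Real.pi ^ 2 / 8 - 1 := by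
  set f : ℕ → ℝ := fun k => 1 / (k : ℝ) ^ 2 with hf
  set g : ℕ → ℝ := fun k => if Even k then f k else 0 with hg
  have h1 : HasSum f (Real.pi ^ 2 / 6) := hasSum_zeta_two
  have h2 : HasSum g (1 / 4 * (Real.pi ^ 2 / 6)) := by
    have hinj : Function.Injective fun n : ℕ => 2 * n := fun a b h => by
      simpa using h
    rw [← hinj.hasSum_iff]
    · refine (h1.mul_left (1 / 4)).congr_fun fun n => ?_
      simp only [Function.comp, hg, hf, even_two_mul, if_true]
      push_cast
      rw [mul_pow, one_div_mul_one_div]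
      norm_num
    · intro k hk
      simp only [hg, ite_eq_right_iff]
      intro he
      obtain ⟨m, rfl⟩ := he.two_dvd
      exact absurd ⟨m, rfl⟩ hk
  have h3 := h1.sub h2
  have h1s : 1 ∉ s := fun h => by have := (hs 1 h).1; omega
  have h4 := sum_le_hasSum (insert 1 s) (fun k _ => by
    simp only [hg, hf]
    split_ifs
    · simp
    · rw [sub_zero]; positivity) h3
  rw [Finset.sum_insert h1s] at h4
  have h5 : ∑ k ∈ s, (f k - g k) = ∑ k ∈ s, f k := Finset.sum_congr rfl fun k hk => by
    simp [hg, Nat.not_even_iff_odd.2 (hs k hk).2]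
  rw [h5] at h4
  simp [hg, hf] at h4 ⊢
  linarith

theorem ConcaveOn.add_le_add_of_add_eq {s : Set ℝ} {f : ℝ → ℝ} (hf : ConcaveOn ℝ s f)
    {a b c d : ℝ} (ha : a ∈ s) (hd : d ∈ s) (hab : a ≤ b) (hac : a ≤ c) (h : a + d = b + c) :
    f a + f d ≤ f b + f c := by
  rcases hab.eq_or_lt with rfl | hab
  · rw [add_left_cancel h]
  have had : a < d := by linarith
  set t := (b - a) / (d - a) with ht
  have ht0 : 0 ≤ t := div_nonneg (by linarith) (by linarith)
  have ht1 : t ≤ 1 := by rw [ht, div_le_one (by linarith)]; linarith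
  have htb : t * (d - a) = b - a := div_mul_cancel₀ _ (by linarith)
  have h1 := hf.2 ha hd (sub_nonneg.2 ht1) ht0 (by ring)
  have h2 := hf.2 ha hd ht0 (sub_nonneg.2 ht1) (by ring)
  simp only [smul_eq_mul] at h1 h2
  rw [show (1 - t) * a + t * d = b by linarith] at h1
  rw [show t * a + (1 - t) * d = c by linarith] at h2
  linarith

/-- Cross-multiplied monotonicity of `(1 - z)^p / (1 - z^p)`. It is concavity of `t^p` at the points
`(1-w)z ≤ 1-w, (1-z)w ≤ 1-z`, whose outer and inner pairs have the same sum. -/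
theorem one_sub_rpow_mul_le {p z w : ℝ} (hp0 : 0 < p) (hp1 : p ≤ 1) (hz : 0 ≤ z) (hzw : z ≤ w)
    (hw : w ≤ 1) : (1 - z) ^ p * (1 - w ^ p) ≤ (1 - w) ^ p * (1 - z ^ p) := by
  have h := (Real.concaveOn_rpow hp0.le hp1).add_le_add_of_add_eq (a := (1 - w) * z) (b := 1 - w)
    (c := (1 - z) * w) (d := 1 - z) (mem_Ici.2 (mul_nonneg (by linarith) hz))
    (mem_Ici.2 (by linarith)) (by nlinarith) (by nlinarith) (by ring)
  rw [Real.mul_rpow (by linarith) hz, Real.mul_rpow (by linarith) (by linarith)] at h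
  linarith

/-- If `z^q + y^q = 1`, the power mean inequality gives `z + y ≤ 2^(1 - 1/q)`, and Bernoulli bounds
this by `2 - 1/q`. The resulting piecewise linear bound has an elementary integral. -/
theorem rpow_add_le_of_conj {q y : ℝ} (hq : 1 < q) (hy : 0 ≤ y) (hy1 : y ≤ 1) :
    (1 - y ^ q) ^ (1 / q) ≤ min 1 (1 + (1 - 1 / q) - y) := by
  have h0 : 0 < q := by linarith
  have hyq : 0 ≤ y ^ q := Real.rpow_nonneg hy q
  have hyq1 : 0 ≤ 1 - y ^ q := by linarith [Real.rpow_le_one hy hy1 h0.le]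
  refine le_min (Real.rpow_le_one hyq1 (by linarith) (by positivity)) ?_
  set z := (1 - y ^ q) ^ (1 / q) with hz
  have hz0 : 0 ≤ z := Real.rpow_nonneg hyq1 _
  have hzq : z ^ q = 1 - y ^ q := by
    rw [hz, ← Real.rpow_mul hyq1, one_div_mul_cancel h0.ne', Real.rpow_one]
  have h1 : (z + y) ^ q ≤ 2 ^ (q - 1) * (z ^ q + y ^ q) := by
    exact_mod_cast NNReal.rpow_add_le_mul_rpow_add_rpow ⟨z, hz0⟩ ⟨y, hy⟩ hq.le
  rw [hzq, sub_add_cancel, mul_one] at h1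
  have h2 : z + y ≤ 2 ^ (1 - 1 / q) := by
    have h3 := Real.rpow_le_rpow (by positivity) h1 (by positivity : 0 ≤ 1 / q)
    rwa [← Real.rpow_mul (by positivity), ← Real.rpow_mul (by positivity),
      mul_one_div_cancel h0.ne', Real.rpow_one, sub_mul, one_mul, mul_one_div_cancel h0.ne'] at h3
  have h4 : (2 : ℝ) ^ (1 - 1 / q) ≤ 1 + (1 - 1 / q) * 1 := by
    have := rpow_one_add_le_one_add_mul_self (s := 1) (by norm_num)
      (sub_nonneg.2 ((div_le_one h0).2 hq.le)) (sub_le_self 1 (by positivity))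
    rwa [one_add_one_eq_two] at this
  linarith

theorem integral_min_one_sub {r : ℝ} (hr0 : 0 ≤ r) (hr1 : r ≤ 1) :
    ∫ y in (0 : ℝ)..1, min 1 (1 + r - y) = 1 - (1 - r) ^ 2 / 2 := by
  have hc : Continuous fun y : ℝ => min 1 (1 + r - y) := by fun_prop
  rw [← intervalIntegral.integral_add_adjacent_intervals (b := r) (hc.intervalIntegrable _ _)
    (hc.intervalIntegrable _ _)]
  have h1 : ∫ y in (0 : ℝ)..r, min 1 (1 + r - y) = ∫ y in (0 : ℝ)..r, (1 : ℝ) := by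
    refine intervalIntegral.integral_congr fun y hy => ?_
    rw [uIcc_of_le hr0] at hy
    exact min_eq_left (by linarith [hy.2])
  have h2 : ∫ y in r..1, min 1 (1 + r - y) = ∫ y in r..1, (1 + r - y) := by
    refine intervalIntegral.integral_congr fun y hy => ?_
    rw [uIcc_of_le hr1] at hy
    exact min_eq_right (by linarith [hy.1])
  rw [h1, h2, intervalIntegral.integral_sub (by simp) (by simp)]
  simp
  ring

/-- In terms of `p = 1/q ∈ [1/2, 11/12]` this reads `8 p (1 - p²/2) (π² - 8) < π³ sin (π p)`. Both
sides are replaced by linear functions of `11/12 - p`; the margin is thin at `p = 11/12`. -/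
theorem piQ_bound_of_le_two {q : ℝ} (hq : 12 / 11 ≤ q) (hq2 : q ≤ 2) :
    2 * piQ q * (1 - (1 / q) ^ 2 / 2) * (Real.pi ^ 2 - 8) < Real.pi ^ 4 / 2 := by
  have h0 : 0 < q := by linarith
  set p := 1 / q with hp
  have hp1 : p ≤ 11 / 12 := by rw [hp, div_le_iff₀ h0]; linarith
  have hp2 : 1 / 2 ≤ p := by rw [hp, le_div_iff₀ h0]; linarith
  have hπ1 := Real.pi_gt_d6
  have hπ2 := Real.pi_lt_d6
  set s := Real.sin (Real.pi * p) with hs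
  have hpi : piQ q = 2 * Real.pi * p / s := by
    rw [piQ, hs, hp]
    rw [show Real.pi / q = Real.pi * (1 / q) by ring]
    field_simp
  have hs12 : (0.2588 : ℝ) ≤ Real.sin (Real.pi * (11 / 12)) := by
    rw [show Real.pi * (11 / 12) = Real.pi - (Real.pi / 3 - Real.pi / 4) by ring,
      Real.sin_pi_sub, Real.sin_sub, Real.sin_pi_div_three, Real.cos_pi_div_three,
      Real.sin_pi_div_four, Real.cos_pi_div_four]
    have h2 : (1.4142 : ℝ) ≤ √2 := Real.le_sqrt_of_sq_le (by norm_num)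
    have h3 : (1.73205 : ℝ) ≤ √3 := Real.le_sqrt_of_sq_le (by norm_num)
    nlinarith [mul_le_mul_of_nonneg_left h3 (Real.sqrt_nonneg 2)]
  -- The sine lies above its chord over `p ∈ [1/2, 11/12]`; `1.7788` is the slope `(1 - 0.2588) /
  -- (5/12)` rounded down.
  have hchord : (0.2588 : ℝ) + 1.7788 * (11 / 12 - p) ≤ s := by
    set t := (11 / 12 - p) * (12 / 5) with ht
    have ht0 : 0 ≤ t := by rw [ht]; linarith
    have ht1 : t ≤ 1 := by rw [ht]; linarith
    have h := strictConcaveOn_sin_Icc.concaveOn.2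
      (x := Real.pi * (11 / 12)) (y := Real.pi * (1 / 2))
      ⟨by positivity, by linarith⟩ ⟨by positivity, by linarith⟩
      (sub_nonneg.2 ht1) ht0 (by ring)
    simp only [smul_eq_mul] at h
    rw [show (1 - t) * (Real.pi * (11 / 12)) + t * (Real.pi * (1 / 2)) = Real.pi * p by
        rw [ht]; ring, show Real.pi * (1 / 2) = Real.pi / 2 by ring, Real.sin_pi_div_two] at h
    have h' : (1 - t) * 0.2588 ≤ (1 - t) * Real.sin (Real.pi * (11 / 12)) :=
      mul_le_mul_of_nonneg_left hs12 (by linarith)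
    rw [← hs] at h
    rw [ht] at h h'
    linarith
  have hs0 : 0 < s := by linarith
  rw [hpi]
  -- The concave cubic lies below its tangent at `11/12`, with value and slope rounded up.
  have hcub : p * (1 - p ^ 2 / 2) ≤ 0.5316 + 0.27 * (11 / 12 - p) := by
    nlinarith [mul_nonneg (sub_nonneg.2 hp1) (sub_nonneg.2 hp2), sq_nonneg (p - 11 / 12),
      mul_nonneg (sub_nonneg.2 hp2) (sq_nonneg (p - 11 / 12))]
  have hpisq : Real.pi ^ 2 ≤ 9.86961 := by nlinarith
  have hpicu : 31.0062 ≤ Real.pi ^ 3 := by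
    have : 9.8696 ≤ Real.pi ^ 2 := by nlinarith
    nlinarith
  have hpi8 : 0 ≤ Real.pi ^ 2 - 8 := by nlinarith
  have hmain : 8 * (p * (1 - p ^ 2 / 2)) * (Real.pi ^ 2 - 8) < Real.pi ^ 3 * s := by
    calc 8 * (p * (1 - p ^ 2 / 2)) * (Real.pi ^ 2 - 8)
        ≤ 8 * (0.5316 + 0.27 * (11 / 12 - p)) * 1.86961 := by
          refine mul_le_mul (by linarith) (by linarith) hpi8 (by linarith)
      _ < 31.0062 * (0.2588 + 1.7788 * (11 / 12 - p)) := by linarith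
      _ ≤ Real.pi ^ 3 * s := mul_le_mul hpicu hchord (by linarith) (by positivity)
  have : 2 * (2 * Real.pi * p / s) * (1 - p ^ 2 / 2) * (Real.pi ^ 2 - 8) =
      Real.pi / 2 * (8 * (p * (1 - p ^ 2 / 2)) * (Real.pi ^ 2 - 8)) / s := by
    ring
  rw [this, div_lt_iff₀ hs0]
  nlinarith [mul_lt_mul_of_pos_left hmain (half_pos Real.pi_pos)]

theorem piQ_le_pi {q : ℝ} (hq : 2 ≤ q) : piQ q ≤ Real.pi := by
  have h0 : 0 < q := by linarith
  have h1 : 2 / Real.pi * (Real.pi / q) ≤ Real.sin (Real.pi / q) := by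
    refine Real.mul_le_sin (by positivity) ?_
    exact div_le_div_of_nonneg_left Real.pi_pos.le (by norm_num) hq
  have h2 : 2 ≤ q * Real.sin (Real.pi / q) := by
    have := mul_le_mul_of_nonneg_left h1 h0.le
    have h3 : q * (2 / Real.pi * (Real.pi / q)) = 2 := by field_simp
    linarith
  rw [piQ, div_le_iff₀ (by linarith)]
  nlinarith [Real.pi_pos]

/-! ### Comparison of the first `q`-sine with the sine. -/

theorem le_of_arcsinQ_le {q y z : ℝ} (hq : 1 < q) (hy : |y| ≤ 1) (hz : |z| ≤ 1)
    (h : arcsinQ q y ≤ arcsinQ q z) : y ≤ z :=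
  ((strictMonoOn_arcsinQ hq).le_iff_le (abs_le.1 hy) (abs_le.1 hz)).1 h

theorem monotoneOn_arcsinQKernel {q : ℝ} (hq : 1 < q) :
    MonotoneOn (arcsinQKernel q) (Ioo 0 1) := by
  intro y hy z hz hyz
  have h0 : 0 < q := by linarith
  have hz1 : |z| < 1 := by rw [abs_of_pos hz.1]; exact hz.2
  refine Real.rpow_le_rpow_of_nonpos (one_sub_abs_rpow_pos hq hz1) ?_
    (neg_nonpos.2 (by positivity))
  rw [abs_of_pos hy.1, abs_of_pos hz.1]
  linarith [Real.rpow_le_rpow hy.1.le hyz h0.le]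

/-- The kernel increases on `(0,1)`, so the arcsine is convex there and lies below its chord. -/
theorem arcsinQ_le_mul {q y : ℝ} (hq : 1 < q) (hy : y ∈ Icc (0 : ℝ) 1) :
    arcsinQ q y ≤ y * (piQ q / 2) := by
  have hd : ∀ x ∈ Ioo (0 : ℝ) 1, HasDerivAt (arcsinQ q) (arcsinQKernel q x) x := fun x hx =>
    hasDerivAt_arcsinQ hq (by rw [abs_of_pos hx.1]; exact hx.2)
  have hconv : ConvexOn ℝ (Icc (0 : ℝ) 1) (arcsinQ q) := by
    refine MonotoneOn.convexOn_of_deriv (convex_Icc _ _)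
      ((continuousOn_arcsinQ hq).mono (Icc_subset_Icc_left (by norm_num))) ?_ ?_ <;>
      rw [interior_Icc]
    · exact fun x hx => (hd x hx).differentiableAt.differentiableWithinAt
    · exact (monotoneOn_arcsinQKernel hq).congr fun x hx => (hd x hx).deriv.symm
  have := hconv.2 (x := 0) (y := 1) (by norm_num) (by norm_num) (sub_nonneg.2 hy.2) hy.1 (by ring)
  simpa [arcsinQ_zero, arcsinQ_one hq] using this

/-- In the variable `sin² x` the derivative of `arcsinQ q ∘ sin` is a power of the quotient in
`one_sub_rpow_mul_le` with exponent `q/2`, hence monotone when `q ≤ 2`. -/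
theorem arcsinQKernel_sin_mul_cos {q x : ℝ} (hq : 1 < q) (hs : 0 < Real.sin x)
    (hc : 0 < Real.cos x) :
    arcsinQKernel q (Real.sin x) * Real.cos x =
      ((1 - Real.sin x ^ 2) ^ (q / 2) / (1 - (Real.sin x ^ 2) ^ (q / 2))) ^ (1 / q) := by
  have h0 : 0 < q := by linarith
  have hs1 : |Real.sin x| < 1 := by
    rw [abs_of_pos hs]
    nlinarith [Real.sin_sq_add_cos_sq x, Real.sin_le_one x]
  have e1 : (Real.sin x ^ 2) ^ (q / 2) = |Real.sin x| ^ q := by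
    rw [abs_of_pos hs, ← Real.rpow_natCast, ← Real.rpow_mul hs.le]
    congr 1; push_cast; ring
  have e2 : (1 - Real.sin x ^ 2) ^ (q / 2) = Real.cos x ^ q := by
    rw [← Real.cos_sq', ← Real.rpow_natCast, ← Real.rpow_mul hc.le]
    congr 1; push_cast; ring
  have hp := one_sub_abs_rpow_pos hq hs1
  rw [e1, e2, Real.div_rpow (by positivity) hp.le, ← Real.rpow_mul hc.le,
    mul_one_div_cancel h0.ne', Real.rpow_one, arcsinQKernel, Real.rpow_neg hp.le]
  ring

theorem arcsinQ_sin_le {q x : ℝ} (hq : 1 < q) (hq2 : q ≤ 2) (hx : x ∈ Icc (0 : ℝ) (1 / 2)) :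
    arcsinQ q (Real.sin (Real.pi * x)) ≤ piQ q * x := by
  have hpi := Real.pi_pos
  have h0 : 0 < q := by linarith
  have hsin : ∀ x ∈ Ioo (0 : ℝ) (1 / 2), 0 < Real.sin (Real.pi * x) := fun x hx =>
    Real.sin_pos_of_pos_of_lt_pi (mul_pos hpi hx.1) (by nlinarith [hx.2])
  have hcos : ∀ x ∈ Ioo (0 : ℝ) (1 / 2), 0 < Real.cos (Real.pi * x) := fun x hx =>
    Real.cos_pos_of_mem_Ioo ⟨by nlinarith [hx.1], by nlinarith [hx.2]⟩
  have hlt : ∀ x ∈ Ioo (0 : ℝ) (1 / 2), Real.sin (Real.pi * x) < 1 := fun x hx => by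
    nlinarith [Real.sin_sq_add_cos_sq (Real.pi * x), Real.sin_le_one (Real.pi * x), hcos x hx]
  have hd : ∀ x ∈ Ioo (0 : ℝ) (1 / 2), HasDerivAt (fun x => arcsinQ q (Real.sin (Real.pi * x)))
      (Real.pi * (arcsinQKernel q (Real.sin (Real.pi * x)) * Real.cos (Real.pi * x))) x := by
    intro x hx
    have h1 : HasDerivAt (fun x => Real.sin (Real.pi * x)) (Real.cos (Real.pi * x) * Real.pi) x := by
      simpa using ((hasDerivAt_id x).const_mul Real.pi).sin
    refine ((hasDerivAt_arcsinQ hq ?_).comp x h1).congr_deriv (by ring)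
    rw [abs_of_pos (hsin x hx)]
    exact hlt x hx
  have hconv : ConvexOn ℝ (Icc (0 : ℝ) (1 / 2)) (fun x => arcsinQ q (Real.sin (Real.pi * x))) := by
    refine MonotoneOn.convexOn_of_deriv (convex_Icc _ _) ?_ ?_ ?_
    · exact (continuousOn_arcsinQ hq).comp (by fun_prop) fun x _ => Real.sin_mem_Icc _
    · rw [interior_Icc]
      exact fun x hx => (hd x hx).differentiableAt.differentiableWithinAt
    · rw [interior_Icc]
      intro x hx y hy hxy
      rw [(hd x hx).deriv, (hd y hy).deriv, arcsinQKernel_sin_mul_cos hq (hsin x hx) (hcos x hx),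
        arcsinQKernel_sin_mul_cos hq (hsin y hy) (hcos y hy)]
      have hs : Real.sin (Real.pi * x) ≤ Real.sin (Real.pi * y) :=
        Real.sin_le_sin_of_le_of_le_pi_div_two (by nlinarith [hx.1]) (by nlinarith [hy.2])
          (by nlinarith)
      set a := Real.sin (Real.pi * x)
      set b := Real.sin (Real.pi * y)
      have ha := hsin x hx
      have hb := hsin y hy
      have ha1 := hlt x hx
      have hb1 := hlt y hy
      have hden : ∀ t : ℝ, 0 < t → t < 1 → 0 < 1 - (t ^ 2) ^ (q / 2) := fun t ht ht1 => by
        have := Real.rpow_lt_one (sq_nonneg t) (by nlinarith : t ^ 2 < 1) (by positivity : 0 < q / 2)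
        linarith
      have hnum : ∀ t : ℝ, 0 < t → t < 1 → 0 ≤ (1 - t ^ 2) ^ (q / 2) := fun t ht ht1 =>
        Real.rpow_nonneg (by nlinarith) _
      refine mul_le_mul_of_nonneg_left (Real.rpow_le_rpow
        (div_nonneg (hnum a ha ha1) (hden a ha ha1).le) ?_ (by positivity)) hpi.le
      rw [div_le_div_iff₀ (hden a ha ha1) (hden b hb hb1)]
      exact one_sub_rpow_mul_le (by positivity) (by linarith) (sq_nonneg a) (by nlinarith)
        (by nlinarith)
  have := hconv.2 (x := 0) (y := 1 / 2) (by norm_num) (by norm_num)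
    (by linarith [hx.2] : 0 ≤ 1 - 2 * x) (by linarith [hx.1] : 0 ≤ 2 * x) (by ring)
  simp only [smul_eq_mul, mul_zero, zero_add, Real.sin_zero, arcsinQ_zero] at this
  rw [show 2 * x * (1 / 2) = x by ring, show Real.pi * (1 / 2) = Real.pi / 2 by ring,
    Real.sin_pi_div_two, arcsinQ_one hq] at this
  linarith

namespace IsQSine

variable {q : ℝ} {F : ℝ → ℝ}

theorem arcsinQ_eq_mul (hF : IsQSine q 1 F) (hq : 1 < q) {x : ℝ}
    (hx : x ∈ Icc (0 : ℝ) (1 / 2)) : arcsinQ q (F x) = piQ q * x := by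
  have := hF.arcsinQ_eq hq le_rfl 0 (x := x) ⟨hx.1, by linarith [hx.2]⟩ (by
    rw [abs_le]; constructor <;> norm_num <;> linarith [hx.1, hx.2])
  simpa using this

theorem le_of_arcsinQ_le_mul (hF : IsQSine q 1 F) (hq : 1 < q) {x y : ℝ}
    (hx : x ∈ Icc (0 : ℝ) (1 / 2)) (hy : |y| ≤ 1) (h : arcsinQ q y ≤ piQ q * x) : y ≤ F x := by
  refine le_of_arcsinQ_le hq hy (hF.abs_le_one hq le_rfl ⟨hx.1, by linarith [hx.2]⟩) ?_
  rwa [hF.arcsinQ_eq_mul hq hx]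

theorem apply_half (hF : IsQSine q 1 F) (hq : 1 < q) : F (1 / 2) = 1 := by
  refine arcsinQ_inj hq (hF.abs_le_one hq le_rfl (by norm_num)) (by simp) ?_
  rw [hF.arcsinQ_eq_mul hq (by norm_num), arcsinQ_one hq]
  ring

theorem monotoneOn (hF : IsQSine q 1 F) (hq : 1 < q) : MonotoneOn F (Icc 0 (1 / 2)) := by
  intro x hx y hy hxy
  refine hF.le_of_arcsinQ_le_mul hq hy (hF.abs_le_one hq le_rfl ⟨hx.1, by linarith [hx.2]⟩) ?_
  rw [hF.arcsinQ_eq_mul hq hx]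
  exact mul_le_mul_of_nonneg_left hxy (piQ_pos hq).le

theorem nonneg_of_le_half (hF : IsQSine q 1 F) (hq : 1 < q) {x : ℝ}
    (hx : x ∈ Icc (0 : ℝ) (1 / 2)) : 0 ≤ F x := by
  have := hF.monotoneOn hq (by norm_num) hx hx.1
  rwa [hF.solution.left_zero] at this

/-- A lower bound on the first half of the interval extends to the whole interval by symmetry. -/
theorem mul_sin_le_of_le_half (hF : IsQSine q 1 F) (hq : 1 < q) {c : ℝ}
    (h : ∀ x ∈ Icc (0 : ℝ) (1 / 2), c * Real.sin (Real.pi * x) ≤ F x) {x : ℝ}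
    (hx : x ∈ Icc (0 : ℝ) 1) : c * Real.sin (Real.pi * x) ≤ F x := by
  rcases le_total x (1 / 2) with hx' | hx'
  · exact h x ⟨hx.1, hx'⟩
  · have := h (1 - x) ⟨by linarith [hx.2], by linarith⟩
    rwa [hF.symm hq hx, mul_sub, mul_one, Real.sin_pi_sub] at this

/-- On the first half, `(2/π) sin (π x) ≤ 2 x ≤ F x`, the second inequality being the chord bound
for the arcsine. -/
theorem two_div_pi_mul_sin_le (hF : IsQSine q 1 F) (hq : 1 < q) {x : ℝ}
    (hx : x ∈ Icc (0 : ℝ) 1) : 2 / Real.pi * Real.sin (Real.pi * x) ≤ F x := by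
  refine hF.mul_sin_le_of_le_half hq (fun x hx => ?_) hx
  have h1 : 2 / Real.pi * Real.sin (Real.pi * x) ≤ 2 * x := by
    have := mul_le_mul_of_nonneg_left (Real.sin_le (mul_nonneg Real.pi_pos.le hx.1))
      (by positivity : 0 ≤ 2 / Real.pi)
    rwa [show 2 / Real.pi * (Real.pi * x) = 2 * x by field_simp] at this
  refine h1.trans (hF.le_of_arcsinQ_le_mul hq hx ?_ ?_)
  · rw [abs_le]; constructor <;> linarith [hx.1, hx.2]
  · have := arcsinQ_le_mul hq (y := 2 * x) ⟨by linarith [hx.1], by linarith [hx.2]⟩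
    linarith

theorem sin_le (hF : IsQSine q 1 F) (hq : 1 < q) (hq2 : q ≤ 2) {x : ℝ}
    (hx : x ∈ Icc (0 : ℝ) 1) : Real.sin (Real.pi * x) ≤ F x := by
  rw [← one_mul (Real.sin _)]
  refine hF.mul_sin_le_of_le_half hq (fun x hx => ?_) hx
  rw [one_mul]
  exact hF.le_of_arcsinQ_le_mul hq hx (Real.abs_sin_le_one _) (arcsinQ_sin_le hq hq2 hx)

/-! ### The Dirichlet energy of the first `q`-sine. -/

theorem continuousOn (hF : IsQSine q 1 F) : ContinuousOn F (Icc 0 1) :=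
  hF.solution.differentiableOn.continuousOn

theorem derivWithin_nonneg (hF : IsQSine q 1 F) (hq : 1 < q) {x : ℝ}
    (hx : x ∈ Icc (0 : ℝ) (1 / 2)) : 0 ≤ derivWithin F (Icc 0 1) x := by
  have hsub : Icc (0 : ℝ) (1 / 2) ⊆ Icc 0 1 := Icc_subset_Icc_right (by norm_num)
  have h := ((hF.isQFlow hq).hasDeriv x (hsub hx)).mono hsub
  rw [← h.derivWithin (uniqueDiffOn_Icc (by norm_num) x hx)]
  exact (hF.monotoneOn hq).derivWithin_nonneg

theorem sq_derivWithin_symm (hF : IsQSine q 1 F) (hq : 1 < q) {x : ℝ}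
    (hx : x ∈ Icc (0 : ℝ) 1) :
    derivWithin F (Icc 0 1) (1 - x) ^ 2 = derivWithin F (Icc 0 1) x ^ 2 := by
  have hν : 0 < ((1 : ℕ) : ℝ) * piQ q := by simpa using piQ_pos hq
  have hx' : 1 - x ∈ Icc (0 : ℝ) 1 := ⟨by linarith [hx.2], by linarith [hx.1]⟩
  rw [← sq_abs, (hF.isQFlow hq).abs_vel hq hν hx', hF.symm hq hx,
    ← (hF.isQFlow hq).abs_vel hq hν hx, sq_abs]

/-- By symmetry the first half suffices. There `F' = π_q (1 - F^q)^(1/q)`: one factor of `F'²` is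
bounded by `rpow_add_le_of_conj`, the other is the Jacobian of `y = F x`. -/
theorem integral_sq_derivWithin_le (hF : IsQSine q 1 F) (hq : 1 < q) :
    ∫ x in (0 : ℝ)..1, derivWithin F (Icc 0 1) x ^ 2 ≤ 2 * piQ q * (1 - (1 / q) ^ 2 / 2) := by
  set v := derivWithin F (Icc 0 1) with hv
  have h0 : 0 < q := by linarith
  have hflow := hF.isQFlow hq
  rw [← hv] at hflow
  have hp := piQ_pos hq
  have hν : 0 < ((1 : ℕ) : ℝ) * piQ q := by simpa using hp
  have hvc := hflow.continuousOn_vel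
  have hsub : Icc (0 : ℝ) (1 / 2) ⊆ Icc 0 1 := Icc_subset_Icc_right (by norm_num)
  have hsub' : Icc (1 / 2 : ℝ) 1 ⊆ Icc 0 1 := Icc_subset_Icc_left (by norm_num)
  have i1 : IntervalIntegrable (fun x => v x ^ 2) volume 0 (1 / 2) :=
    ((hvc.mono hsub).pow 2).intervalIntegrable_of_Icc (by norm_num)
  have i2 : IntervalIntegrable (fun x => v x ^ 2) volume (1 / 2) 1 :=
    ((hvc.mono hsub').pow 2).intervalIntegrable_of_Icc (by norm_num)
  rw [← intervalIntegral.integral_add_adjacent_intervals i1 i2]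
  have hrefl : ∫ x in (1 / 2 : ℝ)..1, v x ^ 2 = ∫ x in (0 : ℝ)..(1 / 2), v x ^ 2 := by
    have h1 := intervalIntegral.integral_comp_sub_left (a := 0) (b := 1 / 2) (fun x => v x ^ 2) 1
    rw [sub_zero, show (1 : ℝ) - 1 / 2 = 1 / 2 by norm_num] at h1
    rw [← h1]
    refine intervalIntegral.integral_congr fun x hx => ?_
    rw [uIcc_of_le (by norm_num)] at hx
    exact hF.sq_derivWithin_symm hq (hsub hx)
  set g : ℝ → ℝ := fun y => min 1 (1 + (1 - 1 / q) - y) with hg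
  have hgc : Continuous g := by rw [hg]; fun_prop
  have hle : ∀ x ∈ Icc (0 : ℝ) (1 / 2), v x ^ 2 ≤ piQ q * (g (F x) * v x) := by
    intro x hx
    have hv0 := hF.derivWithin_nonneg hq hx
    rw [← hv] at hv0
    have h1 := hflow.abs_vel hq hν (hsub hx)
    have hF0 := hF.nonneg_of_le_half hq hx
    have hF1 := hF.abs_le_one hq le_rfl (hsub hx)
    rw [abs_of_nonneg hv0, abs_of_nonneg hF0, Nat.cast_one, one_mul] at h1
    rw [abs_of_nonneg hF0] at hF1
    have h2 : v x ≤ piQ q * g (F x) := by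
      rw [h1]
      exact mul_le_mul_of_nonneg_left (rpow_add_le_of_conj hq hF0 hF1) hp.le
    nlinarith
  have hFc : ContinuousOn F (Icc 0 (1 / 2)) := hF.continuousOn.mono hsub
  have hhalf : ∫ x in (0 : ℝ)..(1 / 2), v x ^ 2 ≤ piQ q * (1 - (1 / q) ^ 2 / 2) := by
    have h1 : ∫ x in (0 : ℝ)..(1 / 2), v x ^ 2 ≤
        ∫ x in (0 : ℝ)..(1 / 2), piQ q * (g (F x) * v x) := by
      refine intervalIntegral.integral_mono_on (by norm_num) i1 ?_ hle
      exact (continuousOn_const.mul ((hgc.comp_continuousOn hFc).mul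
        (hvc.mono hsub))).intervalIntegrable_of_Icc (by norm_num)
    have h2 : ∫ x in (0 : ℝ)..(1 / 2), g (F x) * v x = ∫ y in (0 : ℝ)..1, g y := by
      have := intervalIntegral.integral_comp_mul_deriv'' (a := 0) (b := 1 / 2) (f := F) (f' := v)
        (g := g) (by rwa [uIcc_of_le (by norm_num)]) (fun x hx => by
          rw [min_eq_left (by norm_num), max_eq_right (by norm_num)] at hx
          exact (hflow.hasDerivAt ⟨hx.1, by linarith [hx.2]⟩).hasDerivWithinAt)
        (by rw [uIcc_of_le (by norm_num)]; exact hvc.mono hsub) hgc.continuousOn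
      rw [hF.solution.left_zero, hF.apply_half hq] at this
      exact this
    rw [intervalIntegral.integral_const_mul, h2, hg, integral_min_one_sub
      (sub_nonneg.2 ((div_le_one h0).2 hq.le)) (sub_le_self 1 (by positivity)),
      sub_sub_cancel] at h1
    exact h1
  rw [hrefl]
  linarith

end IsQSine

/-! ### Bessel's inequality for cosines. -/

theorem sineCoeff_eq_intervalIntegral (g : ℝ → ℝ) (j : ℕ) :
    sineCoeff g j = √2 * ∫ x in (0 : ℝ)..1, g x * Real.sin (j * Real.pi * x) := by
  rw [sineCoeff, intervalIntegral.integral_of_le zero_le_one, integral_Ioc_eq_integral_Ioo]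

theorem integral_cos_int_mul_pi (m : ℤ) :
    ∫ x in (0 : ℝ)..1, Real.cos (m * Real.pi * x) = if m = 0 then 1 else 0 := by
  split_ifs with h
  · simp [h]
  · have hm : (m : ℝ) * Real.pi ≠ 0 := mul_ne_zero (by exact_mod_cast h) Real.pi_ne_zero
    rw [intervalIntegral.integral_comp_mul_left _ hm]
    simp [Real.sin_int_mul_pi]

theorem integral_cos_mul_cos {k l : ℕ} (hk : 1 ≤ k) (hl : 1 ≤ l) :
    ∫ x in (0 : ℝ)..1, (√2 * Real.cos (k * Real.pi * x)) * (√2 * Real.cos (l * Real.pi * x)) =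
      if k = l then 1 else 0 := by
  have h : ∀ x : ℝ, (√2 * Real.cos (k * Real.pi * x)) * (√2 * Real.cos (l * Real.pi * x)) =
      Real.cos (((k : ℤ) - l : ℤ) * Real.pi * x) + Real.cos (((k : ℤ) + l : ℤ) * Real.pi * x) := by
    intro x
    push_cast
    rw [show ((k : ℝ) - l) * Real.pi * x = k * Real.pi * x - l * Real.pi * x by ring,
      show ((k : ℝ) + l) * Real.pi * x = k * Real.pi * x + l * Real.pi * x by ring,
      Real.cos_sub, Real.cos_add]
    linear_combination Real.cos (k * Real.pi * x) * Real.cos (l * Real.pi * x) *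
      (Real.mul_self_sqrt (show (0 : ℝ) ≤ 2 by norm_num))
  simp only [h]
  rw [intervalIntegral.integral_add (Continuous.intervalIntegrable (by fun_prop) _ _)
    (Continuous.intervalIntegrable (by fun_prop) _ _), integral_cos_int_mul_pi,
    integral_cos_int_mul_pi, if_neg (by omega : ¬ (k : ℤ) + l = 0), add_zero]
  exact if_congr (by omega) rfl rfl

/-- Bessel's inequality for the cosine system on `[0,1]`. -/
theorem sum_sq_integral_cos_le {v : ℝ → ℝ} (hv : ContinuousOn v (Icc 0 1)) (s : Finset ℕ)
    (hs : ∀ k ∈ s, 1 ≤ k) :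
    ∑ k ∈ s, (√2 * ∫ x in (0 : ℝ)..1, v x * Real.cos (k * Real.pi * x)) ^ 2 ≤
      ∫ x in (0 : ℝ)..1, v x ^ 2 := by
  set φ : ℕ → ℝ → ℝ := fun k x => √2 * Real.cos (k * Real.pi * x) with hφ
  have hφc : ∀ k, Continuous (φ k) := fun k => by simp only [hφ]; fun_prop
  set c : ℕ → ℝ := fun k => √2 * ∫ x in (0 : ℝ)..1, v x * Real.cos (k * Real.pi * x) with hc
  have hcφ : ∀ k, ∫ x in (0 : ℝ)..1, v x * φ k x = c k := fun k => by
    simp only [hc, hφ, ← intervalIntegral.integral_const_mul]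
    exact intervalIntegral.integral_congr fun x _ => by ring
  set P : ℝ → ℝ := fun x => ∑ k ∈ s, c k * φ k x with hP
  have hPc : Continuous P := by simp only [hP]; fun_prop
  have hφP : ∀ k ∈ s, ∫ x in (0 : ℝ)..1, φ k x * P x = c k := by
    intro k hk
    simp only [hP, Finset.mul_sum]
    have ivk : ∀ l ∈ s, IntervalIntegrable (fun x => φ k x * (c l * φ l x)) volume 0 1 := fun l _ =>
      ((hφc k).mul (continuous_const.mul (hφc l))).intervalIntegrable _ _
    rw [intervalIntegral.integral_finsetSum ivk]
    have : ∀ l ∈ s, ∫ x in (0 : ℝ)..1, φ k x * (c l * φ l x) = if k = l then c l else 0 := by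
      intro l hl
      simp only [mul_left_comm _ (c l)]
      rw [intervalIntegral.integral_const_mul, integral_cos_mul_cos (hs k hk) (hs l hl)]
      simp
    rw [Finset.sum_congr rfl this, Finset.sum_ite_eq, if_pos hk]
  have ivφ : ∀ k, IntervalIntegrable (fun x => v x * φ k x) volume 0 1 := fun k =>
    (hv.mul (hφc k).continuousOn).intervalIntegrable_of_Icc zero_le_one
  have hvP : ∫ x in (0 : ℝ)..1, v x * P x = ∑ k ∈ s, c k ^ 2 := by
    simp only [hP, Finset.mul_sum, mul_left_comm _ (c _)]
    rw [intervalIntegral.integral_finsetSum fun l _ => (ivφ l).const_mul _]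
    refine Finset.sum_congr rfl fun k _ => ?_
    rw [intervalIntegral.integral_const_mul, hcφ, sq]
  have hPP : ∫ x in (0 : ℝ)..1, P x * P x = ∑ k ∈ s, c k ^ 2 := by
    have h : ∀ x, P x * P x = ∑ k ∈ s, c k * (φ k x * P x) := fun x => by
      conv_lhs => rw [hP]
      simp only [Finset.sum_mul, mul_assoc, hP]
    simp only [h]
    have ivl : ∀ l ∈ s, IntervalIntegrable (fun x => c l * (φ l x * P x)) volume 0 1 := fun l _ =>
      (continuous_const.mul ((hφc l).mul hPc)).intervalIntegrable _ _
    rw [intervalIntegral.integral_finsetSum ivl]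
    refine Finset.sum_congr rfl fun k hk => ?_
    rw [intervalIntegral.integral_const_mul, hφP k hk, sq]
  have ivv : IntervalIntegrable (fun x => v x ^ 2) volume 0 1 :=
    (hv.pow 2).intervalIntegrable_of_Icc zero_le_one
  have ivP : IntervalIntegrable (fun x => v x * P x) volume 0 1 :=
    (hv.mul hPc.continuousOn).intervalIntegrable_of_Icc zero_le_one
  have iPP : IntervalIntegrable (fun x => P x * P x) volume 0 1 :=
    (hPc.mul hPc).intervalIntegrable _ _
  have hnn : 0 ≤ ∫ x in (0 : ℝ)..1, (v x ^ 2 - 2 * (v x * P x) + P x * P x) :=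
    intervalIntegral.integral_nonneg zero_le_one fun x _ => by nlinarith [sq_nonneg (v x - P x)]
  rw [intervalIntegral.integral_add (ivv.sub (ivP.const_mul 2)) iPP,
    intervalIntegral.integral_sub ivv (ivP.const_mul 2), intervalIntegral.integral_const_mul,
    hvP, hPP] at hnn
  linarith

/-! ### Domination of the sine coefficients by the first one. -/

namespace IsQSine

variable {q : ℝ} {F : ℝ → ℝ}

/-- Integration by parts, with boundary terms killed by `F 0 = F 1 = 0`; it lets Bessel's inequality
for `F'` control `∑ k² τ(k)²`. -/
theorem mul_sineCoeff (hF : IsQSine q 1 F) (hq : 1 < q) (k : ℕ) :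
    k * Real.pi * sineCoeff F k =
      √2 * ∫ x in (0 : ℝ)..1, derivWithin F (Icc 0 1) x * Real.cos (k * Real.pi * x) := by
  have hflow := hF.isQFlow hq
  set v := derivWithin F (Icc 0 1) with hv
  have hcos : ∀ x : ℝ, HasDerivAt (fun x => Real.cos (k * Real.pi * x))
      (-Real.sin (k * Real.pi * x) * (k * Real.pi)) x := fun x => by
    simpa using ((hasDerivAt_id x).const_mul (k * Real.pi)).cos
  have h := intervalIntegral.integral_deriv_mul_eq_sub_of_hasDeriv_right (a := 0) (b := 1)
    (u := F) (u' := v) (v := fun x => Real.cos (k * Real.pi * x))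
    (v' := fun x => -Real.sin (k * Real.pi * x) * (k * Real.pi))
    (by rw [uIcc_of_le zero_le_one]; exact hF.continuousOn)
    (by fun_prop)
    (fun x hx => by
      rw [min_eq_left zero_le_one, max_eq_right zero_le_one] at hx
      exact (hflow.hasDerivAt hx).hasDerivWithinAt)
    (fun x _ => (hcos x).hasDerivWithinAt)
    (hflow.continuousOn_vel.intervalIntegrable_of_Icc zero_le_one)
    (Continuous.intervalIntegrable (by fun_prop) _ _)
  rw [hF.solution.left_zero, hF.solution.right_zero, zero_mul, zero_mul, sub_zero,
    intervalIntegral.integral_add] at h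
  · have h2 : ∫ x in (0 : ℝ)..1, F x * (-Real.sin (k * Real.pi * x) * (k * Real.pi)) =
        -(k * Real.pi) * ∫ x in (0 : ℝ)..1, F x * Real.sin (k * Real.pi * x) := by
      rw [← intervalIntegral.integral_const_mul]
      exact intervalIntegral.integral_congr fun x _ => by ring
    rw [h2] at h
    rw [sineCoeff_eq_intervalIntegral]
    linear_combination -√2 * h
  · exact (hflow.continuousOn_vel.mul (by fun_prop)).intervalIntegrable_of_Icc zero_le_one
  · exact (hF.continuousOn.mul (by fun_prop)).intervalIntegrable_of_Icc zero_le_one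

theorem sineCoeff_of_even (hF : IsQSine q 1 F) (hq : 1 < q) {k : ℕ} (hk : Even k) :
    sineCoeff F k = 0 := by
  have h1 := intervalIntegral.integral_comp_sub_left (a := 0) (b := 1)
    (fun x => F x * Real.sin (k * Real.pi * x)) 1
  rw [sub_zero, sub_self] at h1
  have h2 : ∫ x in (0 : ℝ)..1, F (1 - x) * Real.sin (k * Real.pi * (1 - x)) =
      -∫ x in (0 : ℝ)..1, F x * Real.sin (k * Real.pi * x) := by
    rw [← intervalIntegral.integral_neg]
    refine intervalIntegral.integral_congr fun x hx => ?_
    rw [uIcc_of_le zero_le_one] at hx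
    rw [hF.symm hq hx, mul_sub, mul_one, Real.sin_nat_mul_pi_sub, hk.neg_one_pow]
    ring
  rw [sineCoeff_eq_intervalIntegral]
  have : ∫ x in (0 : ℝ)..1, F x * Real.sin (k * Real.pi * x) = 0 := by linarith
  rw [this, mul_zero]

theorem le_sineCoeff_one (hF : IsQSine q 1 F) {c : ℝ}
    (h : ∀ x ∈ Icc (0 : ℝ) 1, c * Real.sin (Real.pi * x) ≤ F x) :
    c * (√2 / 2) ≤ sineCoeff F 1 := by
  rw [sineCoeff_eq_intervalIntegral, Nat.cast_one, one_mul]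
  have hsq : ∫ x in (0 : ℝ)..1, Real.sin (Real.pi * x) ^ 2 = 1 / 2 := by
    rw [intervalIntegral.integral_comp_mul_left (fun x => Real.sin x ^ 2) Real.pi_ne_zero]
    simp
    field_simp
  have hmono : ∫ x in (0 : ℝ)..1, c * Real.sin (Real.pi * x) ^ 2 ≤
      ∫ x in (0 : ℝ)..1, F x * Real.sin (Real.pi * x) := by
    refine intervalIntegral.integral_mono_on zero_le_one
      (Continuous.intervalIntegrable (by fun_prop) _ _)
      ((hF.continuousOn.mul (by fun_prop)).intervalIntegrable_of_Icc zero_le_one) fun x hx => ?_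
    have : 0 ≤ Real.sin (Real.pi * x) := Real.sin_nonneg_of_nonneg_of_le_pi
      (mul_nonneg Real.pi_pos.le hx.1) (by nlinarith [Real.pi_pos, hx.2])
    nlinarith [h x hx]
  rw [intervalIntegral.integral_const_mul, hsq] at hmono
  nlinarith [Real.sqrt_nonneg 2]

theorem sineCoeff_one_pos (hF : IsQSine q 1 F) (hq : 1 < q) : 0 < sineCoeff F 1 := by
  refine lt_of_lt_of_le ?_ (hF.le_sineCoeff_one fun x hx => hF.two_div_pi_mul_sin_le hq hx)
  have := Real.pi_pos
  positivity

/-- Exactly what the Cauchy–Schwarz estimate of the tail needs. For `q ≤ 2` it uses `F ≥ sin (π x)`;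
for `q ≥ 2` the cruder `F ≥ (2/π) sin (π x)` and `π_q ≤ π` suffice. -/
theorem energy_lt (hF : IsQSine q 1 F) (hq : 12 / 11 ≤ q) :
    (∫ x in (0 : ℝ)..1, derivWithin F (Icc 0 1) x ^ 2) * (Real.pi ^ 2 - 8) <
      Real.pi ^ 4 * sineCoeff F 1 ^ 2 := by
  have hq1 : 1 < q := by linarith
  have hE := hF.integral_sq_derivWithin_le hq1
  have hπ1 := Real.pi_gt_d6
  have hπ2 := Real.pi_lt_d6
  have h2 : (√2 / 2) ^ 2 = 1 / 2 := by rw [div_pow, Real.sq_sqrt (by norm_num)]; norm_num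
  have hpi8 : 0 ≤ Real.pi ^ 2 - 8 := by nlinarith
  have hE' := mul_le_mul_of_nonneg_right hE hpi8
  rcases le_total q 2 with hq2 | hq2
  · have hτ := hF.le_sineCoeff_one (c := 1) fun x hx => by rw [one_mul]; exact hF.sin_le hq1 hq2 hx
    have hτ2 := pow_le_pow_left₀ (by positivity) hτ 2
    rw [one_mul, h2] at hτ2
    have := mul_le_mul_of_nonneg_left hτ2 (by positivity : 0 ≤ Real.pi ^ 4)
    linarith [piQ_bound_of_le_two hq hq2]
  · have hτ := hF.le_sineCoeff_one fun x hx => hF.two_div_pi_mul_sin_le hq1 hx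
    have hτ2 := pow_le_pow_left₀ (by positivity) hτ 2
    rw [mul_pow, h2] at hτ2
    have h3 := mul_le_mul_of_nonneg_left hτ2 (by positivity : 0 ≤ Real.pi ^ 4)
    have h4 : Real.pi ^ 4 * ((2 / Real.pi) ^ 2 * (1 / 2)) = 2 * Real.pi ^ 2 := by
      field_simp
    have h5 : 2 * piQ q * (1 - (1 / q) ^ 2 / 2) ≤ 2 * Real.pi := by
      have := piQ_le_pi hq2
      have := mul_nonneg (piQ_pos hq1).le (sq_nonneg (1 / q))
      linarith
    have h6 := mul_le_mul_of_nonneg_right h5 hpi8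
    have h7 : Real.pi ^ 2 < 10 := by nlinarith
    nlinarith

/-- The sine coefficients of the first `q`-sine function are dominated by the first one. -/
theorem exists_sum_abs_sineCoeff_le (hF : IsQSine q 1 F) (hq : 12 / 11 ≤ q) :
    ∃ ρ < sineCoeff F 1, ∀ s : Finset ℕ, (∀ k ∈ s, 2 ≤ k) → ∑ k ∈ s, |sineCoeff F k| ≤ ρ := by
  have hq1 : 1 < q := by linarith
  have hπ := Real.pi_gt_d6
  set τ := sineCoeff F with hτ
  set E := ∫ x in (0 : ℝ)..1, derivWithin F (Icc 0 1) x ^ 2 with hE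
  have hτ1 : 0 < τ 1 := hF.sineCoeff_one_pos hq1
  have hen := hF.energy_lt hq
  rw [← hE] at hen
  have hZ : 0 < Real.pi ^ 2 / 8 - 1 := by nlinarith
  refine ⟨√((E / Real.pi ^ 2 - τ 1 ^ 2) * (Real.pi ^ 2 / 8 - 1)), ?_, fun s hs => ?_⟩
  · rw [Real.sqrt_lt' hτ1]
    have hp2 : 0 < Real.pi ^ 2 := by positivity
    have : E / Real.pi ^ 2 * (Real.pi ^ 2 / 8 - 1) < τ 1 ^ 2 * (Real.pi ^ 2 / 8) := by
      rw [div_mul_eq_mul_div, div_lt_iff₀ hp2]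
      nlinarith
    linarith
  · refine Real.le_sqrt_of_sq_le ?_
    set t := s.filter Odd with ht
    have hst : ∑ k ∈ s, |τ k| = ∑ k ∈ t, (k * |τ k|) * (1 / k) := by
      rw [ht, Finset.sum_filter]
      refine Finset.sum_congr rfl fun k hk => ?_
      split_ifs with ho
      · have : (k : ℝ) ≠ 0 := by have := hs k hk; positivity
        field_simp
      · rw [hτ, hF.sineCoeff_of_even hq1 (Nat.not_odd_iff_even.1 ho), abs_zero]
    have ht2 : ∀ k ∈ t, 2 ≤ k ∧ Odd k := fun k hk => by
      rw [ht, Finset.mem_filter] at hk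
      exact ⟨hs k hk.1, hk.2⟩
    have h1t : 1 ∉ t := fun h => by have := (ht2 1 h).1; omega
    -- Including the index `1` subtracts `τ 1 ^ 2` from the bound on the tail.
    have hB := sum_sq_integral_cos_le (hF.isQFlow hq1).continuousOn_vel (insert 1 t)
      (fun k hk => by
        rcases Finset.mem_insert.1 hk with rfl | hk
        · exact le_rfl
        · have := (ht2 k hk).1; omega)
    simp only [← hF.mul_sineCoeff hq1] at hB
    rw [Finset.sum_insert h1t, ← hE, ← hτ] at hB
    have hsum : ∑ k ∈ t, (k * |τ k|) ^ 2 ≤ E / Real.pi ^ 2 - τ 1 ^ 2 := by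
      rw [le_sub_iff_add_le, le_div_iff₀ (by positivity), add_mul, Finset.sum_mul]
      refine le_trans (le_of_eq ?_) hB
      rw [add_comm]
      congr 1
      · push_cast; ring
      · refine Finset.sum_congr rfl fun k _ => ?_
        rw [mul_pow, sq_abs]; ring
    rw [hst]
    refine (Finset.sum_mul_sq_le_sq_mul_sq t _ _).trans ?_
    refine mul_le_mul hsum ?_ (Finset.sum_nonneg fun k _ => sq_nonneg _)
      (le_trans (Finset.sum_nonneg fun k _ => sq_nonneg _) hsum)
    simpa only [one_div, inv_pow] using sum_inv_sq_odd_le t ht2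

theorem summable_abs_sineCoeff (hF : IsQSine q 1 F) (hq : 12 / 11 ≤ q) :
    Summable fun k => |sineCoeff F k| := by
  obtain ⟨ρ, -, h⟩ := hF.exists_sum_abs_sineCoeff_le hq
  rw [← summable_nat_add_iff 2]
  refine summable_of_sum_le (c := ρ) (fun _ => abs_nonneg _) fun s => ?_
  have := h (s.map (addRightEmbedding 2)) fun k hk => by
    obtain ⟨m, -, rfl⟩ := Finset.mem_map.1 hk
    simp
  simpa using this

end IsQSine

/-! ### Pointwise sine expansion. -/

/-- The odd extension of a function on `[0,1]` that vanishes at `0`. -/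
noncomputable def oddExtension (F : ℝ → ℝ) (x : ℝ) : ℝ := F (max x 0) - F (max (-x) 0)

theorem oddExtension_neg (F : ℝ → ℝ) (x : ℝ) : oddExtension F (-x) = -oddExtension F x := by
  simp [oddExtension]

theorem oddExtension_of_nonneg {F : ℝ → ℝ} (hF : F 0 = 0) {x : ℝ} (hx : 0 ≤ x) :
    oddExtension F x = F x := by
  simp [oddExtension, hx, hF]

theorem oddExtension_eq_sign_mul {F : ℝ → ℝ} (hF : F 0 = 0) (x : ℝ) :
    oddExtension F x = SignType.sign x * F |x| := by
  rcases lt_trichotomy x 0 with h | rfl | h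
  · rw [← neg_neg x, oddExtension_neg, oddExtension_of_nonneg hF (by linarith)]
    simp [sign_neg h, abs_of_neg h]
  · simp [oddExtension]
  · rw [oddExtension_of_nonneg hF h.le]
    simp [sign_pos h, abs_of_pos h]

theorem continuousOn_oddExtension {F : ℝ → ℝ} (hF : ContinuousOn F (Icc 0 1)) :
    ContinuousOn (oddExtension F) (Icc (-1) 1) := by
  refine (hF.comp (by fun_prop) fun x hx => ?_).sub (hF.comp (by fun_prop) fun x hx => ?_)
  · exact ⟨le_max_right _ _, max_le hx.2 zero_le_one⟩
  · exact ⟨le_max_right _ _, max_le (by linarith [hx.1]) zero_le_one⟩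

theorem sineCoeff_neg_index (F : ℝ → ℝ) (n : ℤ) :
    ∫ x in (0 : ℝ)..1, F x * Real.sin ((-n : ℤ) * Real.pi * x) =
      -∫ x in (0 : ℝ)..1, F x * Real.sin (n * Real.pi * x) := by
  rw [← intervalIntegral.integral_neg]
  refine intervalIntegral.integral_congr fun x _ => ?_
  push_cast
  rw [neg_mul, neg_mul, Real.sin_neg, mul_neg]

theorem integral_exp_mul_oddExtension {F : ℝ → ℝ} (hF : ContinuousOn F (Icc 0 1)) (h0 : F 0 = 0)
    (n : ℤ) :
    ∫ x in (-1 : ℝ)..1, Complex.exp (-(n * Real.pi * x * Complex.I)) * (oddExtension F x : ℂ) =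
      -2 * Complex.I * ((∫ x in (0 : ℝ)..1, F x * Real.sin (n * Real.pi * x) : ℝ) : ℂ) := by
  have hc : ContinuousOn (fun x : ℝ =>
      Complex.exp (-(n * Real.pi * x * Complex.I)) * (oddExtension F x : ℂ)) (Icc (-1) 1) :=
    ContinuousOn.mul (by fun_prop)
      (Complex.continuous_ofReal.comp_continuousOn (continuousOn_oddExtension hF))
  have i1 := (hc.mono (Icc_subset_Icc_right (by norm_num : (0 : ℝ) ≤ 1))).intervalIntegrable_of_Icc
    (μ := volume) (by norm_num)
  have i2 := (hc.mono (Icc_subset_Icc_left (by norm_num : (-1 : ℝ) ≤ 0))).intervalIntegrable_of_Icc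
    (μ := volume) (by norm_num)
  rw [← intervalIntegral.integral_add_adjacent_intervals i1 i2]
  have hneg := intervalIntegral.integral_comp_neg (a := 0) (b := 1) fun x : ℝ =>
    Complex.exp (-(n * Real.pi * x * Complex.I)) * (oddExtension F x : ℂ)
  rw [neg_zero] at hneg
  rw [← hneg, ← intervalIntegral.integral_add _ i2, ← intervalIntegral.integral_ofReal,
    ← intervalIntegral.integral_const_mul]
  · refine intervalIntegral.integral_congr fun x hx => ?_
    rw [uIcc_of_le zero_le_one] at hx
    simp only [oddExtension_neg, oddExtension_of_nonneg h0 hx.1]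
    push_cast
    rw [show -((n : ℂ) * Real.pi * -(x : ℂ) * Complex.I) = n * Real.pi * x * Complex.I by ring,
      show -((n : ℂ) * Real.pi * (x : ℂ) * Complex.I) = -(n * Real.pi * x) * Complex.I by ring,
      Complex.exp_mul_I, Complex.exp_mul_I, Complex.cos_neg, Complex.sin_neg]
    ring
  · have := (IntervalIntegrable.iff_comp_neg).1 i1
    simpa using this.symm

/-- Pointwise convergence of an absolutely convergent sine series. -/
theorem hasSum_sineCoeff {F : ℝ → ℝ} (hF : ContinuousOn F (Icc 0 1)) (h0 : F 0 = 0)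
    (h1 : F 1 = 0) (hs : Summable fun k => |sineCoeff F k|) {x : ℝ} (hx : x ∈ Ico (-1 : ℝ) 1) :
    HasSum (fun k : ℕ => sineCoeff F k * (√2 * Real.sin (k * Real.pi * x))) (oddExtension F x) := by
  have : Fact (0 < (2 : ℝ)) := ⟨two_pos⟩
  set G : ℝ → ℂ := fun x => (oddExtension F x : ℂ) with hG
  set b : ℤ → ℝ := fun n => ∫ x in (0 : ℝ)..1, F x * Real.sin (n * Real.pi * x) with hb
  have hb2 : ∀ k : ℕ, sineCoeff F k = √2 * b k := fun k => by
    rw [sineCoeff_eq_intervalIntegral, hb]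
    simp
  have hbneg : ∀ n, b (-n) = -b n := fun n => sineCoeff_neg_index F n
  have hGc : Continuous (AddCircle.liftIco 2 (-1) G) := by
    refine AddCircle.liftIco_continuous ?_ ?_
    · have e : oddExtension F 1 = 0 := by rw [oddExtension_of_nonneg h0 zero_le_one, h1]
      rw [show (-1 : ℝ) + 2 = 1 by norm_num, hG]
      simp only [oddExtension_neg, e, neg_zero]
    · rw [show (-1 : ℝ) + 2 = 1 by norm_num]
      exact Complex.continuous_ofReal.comp_continuousOn (continuousOn_oddExtension hF)
  set g : C(AddCircle (2 : ℝ), ℂ) := ⟨_, hGc⟩ with hg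
  have hgx : ∀ y ∈ Ico (-1 : ℝ) 1, g (y : AddCircle (2 : ℝ)) = G y := fun y hy =>
    AddCircle.liftIco_coe_apply (f := G) (by rwa [show (-1 : ℝ) + 2 = 1 by norm_num])
  have hcoeff : ∀ n : ℤ, fourierCoeff g n = -Complex.I * (b n : ℂ) := by
    intro n
    rw [fourierCoeff_eq_intervalIntegral g n (-1), show (-1 : ℝ) + 2 = 1 by norm_num]
    have : ∫ y in (-1 : ℝ)..1, fourier (-n) (y : AddCircle (2 : ℝ)) • g (y : AddCircle (2 : ℝ)) =
        ∫ y in (-1 : ℝ)..1, Complex.exp (-(n * Real.pi * y * Complex.I)) *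
          (oddExtension F y : ℂ) := by
      rw [intervalIntegral.integral_of_le (by norm_num), intervalIntegral.integral_of_le (by norm_num),
        integral_Ioc_eq_integral_Ioo, integral_Ioc_eq_integral_Ioo]
      refine setIntegral_congr_fun measurableSet_Ioo fun y hy => ?_
      simp only [hgx y (Ioo_subset_Ico_self hy), fourier_coe_apply, smul_eq_mul, hG]
      congr 2
      push_cast
      ring
    rw [this, integral_exp_mul_oddExtension hF h0, Complex.real_smul]
    push_cast
    ring
  have hbs : Summable fun k : ℕ => |b k| := by
    refine (hs.mul_left (√2)⁻¹).congr fun k => ?_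
    have : √2 ≠ 0 := by positivity
    rw [hb2, abs_mul, abs_of_pos (by positivity : 0 < √2), inv_mul_cancel_left₀ this]
  have hsum : Summable (fourierCoeff g) := by
    refine Summable.of_norm ?_
    have hn : ∀ n, ‖fourierCoeff g n‖ = |b n| := fun n => by rw [hcoeff]; simp
    simp only [hn]
    exact Summable.of_nat_of_neg hbs (by simpa only [hbneg, abs_neg] using hbs)
  -- The exponentials of index `k` and `-k` combine to a sine because the coefficients are odd in
  -- the index.
  have key := (has_pointwise_sum_fourier_series_of_summable hsum (x : AddCircle (2 : ℝ))).nat_add_neg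
  have hb0 : b 0 = 0 := by simp [hb]
  rw [hgx x hx, hcoeff 0, hb0, Complex.ofReal_zero, mul_zero, zero_smul, add_zero] at key
  rw [← Complex.hasSum_ofReal]
  refine key.congr_fun fun k => ?_
  rw [hcoeff, hcoeff, hbneg, fourier_coe_apply, fourier_coe_apply, hb2]
  push_cast
  rw [show 2 * (Real.pi : ℂ) * Complex.I * k * x / 2 = (k * Real.pi * x) * Complex.I by ring,
    show 2 * (Real.pi : ℂ) * Complex.I * -k * x / 2 = -(k * Real.pi * x) * Complex.I by ring,
    Complex.exp_mul_I, Complex.exp_mul_I, Complex.cos_neg, Complex.sin_neg]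
  have h2 : (√2 : ℂ) * √2 = 2 := by
    rw [← Complex.ofReal_mul, Real.mul_self_sqrt (by norm_num)]
    norm_num
  simp only [smul_eq_mul]
  linear_combination (b k : ℂ) * Complex.sin (k * Real.pi * x) * (h2 + 2 * Complex.I_mul_I)

/-! ### Expansion of all `q`-sines and pairing with the dual family. -/

/-- With `m` an integer nearest to `n x`, the shift by `m` multiplies `f_n` by `(-1)^m`, and
likewise every sine of odd index `k`; the even coefficients vanish. -/
theorem IsQSine.hasSum {q : ℝ} (hq : 12 / 11 ≤ q) {n : ℕ} (hn : 1 ≤ n) {F u : ℝ → ℝ}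
    (hF : IsQSine q 1 F) (h : IsQSine q n u) {x : ℝ} (hx : x ∈ Icc (0 : ℝ) 1) :
    HasSum (fun k : ℕ => sineCoeff F k * sineBasis (n * k) x) (u x) := by
  have hq1 : 1 < q := by linarith
  have hnx : 0 ≤ n * x := mul_nonneg n.cast_nonneg hx.1
  set m := ⌊n * x + 1 / 2⌋₊ with hm
  set s := n * x - m with hs
  have hsle : |s| ≤ 1 / 2 := by
    have h1 := Nat.floor_le (by positivity : 0 ≤ n * x + 1 / 2)
    have h2 := Nat.lt_floor_add_one (n * x + 1 / 2)
    rw [← hm] at h1 h2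
    rw [abs_le]
    constructor <;> linarith
  obtain ⟨hs1, hs2⟩ := abs_le.1 hsle
  rw [hF.eq_of_abs_sub_le hq1 hn h m hx hsle,
    ← oddExtension_eq_sign_mul hF.solution.left_zero]
  have hsum := (hasSum_sineCoeff hF.continuousOn hF.solution.left_zero hF.solution.right_zero
    (hF.summable_abs_sineCoeff hq) (x := s) ⟨by linarith, by linarith⟩).mul_left ((-1) ^ m)
  refine hsum.congr_fun fun k => ?_
  rcases Nat.even_or_odd k with hk | hk
  · rw [hF.sineCoeff_of_even hq1 hk]
    ring
  · have : Real.sin ((n * k : ℕ) * Real.pi * x) = (-1) ^ m * Real.sin (k * Real.pi * s) := by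
      rw [show ((n * k : ℕ) : ℝ) * Real.pi * x = k * Real.pi * s + (k * m : ℕ) * Real.pi by
        rw [hs]; push_cast; ring, Real.sin_add_nat_mul_pi, pow_mul, hk.neg_one_pow]
    rw [sineBasis, this]
    ring

theorem norm_sineBasis_le (l : ℕ) (x : ℝ) : ‖sineBasis l x‖ ≤ √2 := by
  rw [sineBasis, norm_mul, Real.norm_of_nonneg (Real.sqrt_nonneg 2)]
  exact mul_le_of_le_one_right (Real.sqrt_nonneg 2) (Real.abs_sin_le_one _)

theorem integrableOn_sineBasis_mul {h : ℝ → ℝ} (hh : IntegrableOn h (Ioo 0 1)) (l : ℕ) :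
    IntegrableOn (fun x => sineBasis l x * h x) (Ioo 0 1) :=
  hh.bdd_mul (c := √2) (by unfold sineBasis; fun_prop) (Eventually.of_forall (norm_sineBasis_le l))

theorem integral_norm_sineBasis_mul_le {h : ℝ → ℝ} (hh : IntegrableOn h (Ioo 0 1)) (l : ℕ) :
    ∫ x in Ioo (0 : ℝ) 1, ‖sineBasis l x * h x‖ ≤ √2 * ∫ x in Ioo (0 : ℝ) 1, ‖h x‖ := by
  rw [← integral_const_mul]
  refine integral_mono (integrableOn_sineBasis_mul hh l).norm (hh.norm.const_mul _) fun x => ?_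
  simp only [norm_mul]
  exact mul_le_mul_of_nonneg_right (norm_sineBasis_le l x) (norm_nonneg _)

theorem abs_innerL2_sineBasis_le {h : ℝ → ℝ} (hh : IntegrableOn h (Ioo 0 1)) (l : ℕ) :
    |innerL2 (sineBasis l) h| ≤ √2 * ∫ x in Ioo (0 : ℝ) 1, ‖h x‖ :=
  (norm_integral_le_integral_norm _).trans (integral_norm_sineBasis_mul_le hh l)

/-- Absolute summability of the coefficients and boundedness of the sines justify termwise
integration against any integrable `h`, without completeness of the basis. -/
theorem IsQSine.hasSum_innerL2 {q : ℝ} (hq : 12 / 11 ≤ q) {n : ℕ} (hn : 1 ≤ n) {F u h : ℝ → ℝ}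
    (hF : IsQSine q 1 F) (hu : IsQSine q n u) (hh : IntegrableOn h (Ioo 0 1)) :
    HasSum (fun k : ℕ => sineCoeff F k * innerL2 (sineBasis (n * k)) h) (innerL2 u h) := by
  have hsum : Summable fun k : ℕ => ∫ x in Ioo (0 : ℝ) 1,
      ‖sineCoeff F k * (sineBasis (n * k) x * h x)‖ := by
    refine Summable.of_nonneg_of_le (fun k => integral_nonneg fun x => norm_nonneg _) (fun k => ?_)
      ((hF.summable_abs_sineCoeff hq).mul_right (√2 * ∫ x in Ioo (0 : ℝ) 1, ‖h x‖))
    simp only [norm_mul (sineCoeff F k), integral_const_mul, Real.norm_eq_abs (sineCoeff F k)]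
    exact mul_le_mul_of_nonneg_left (integral_norm_sineBasis_mul_le hh _) (abs_nonneg _)
  have key := hasSum_integral_of_summable_integral_norm
    (fun k => (integrableOn_sineBasis_mul hh (n * k)).const_mul (sineCoeff F k)) hsum
  simp only [integral_const_mul] at key
  have : innerL2 u h = ∫ x in Ioo (0 : ℝ) 1,
      ∑' k, sineCoeff F k * (sineBasis (n * k) x * h x) := by
    refine setIntegral_congr_fun measurableSet_Ioo fun x hx => ?_
    have := (hF.hasSum hq hn hu (Ioo_subset_Icc_self hx)).mul_right (h x)
    simp only [mul_assoc] at this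
    exact this.tsum_eq.symm
  rw [this]
  exact key

/-! ### Uniqueness and solution of the dilation system. -/

/-- A bounded sequence annihilated by all dilations of a dominated sequence vanishes. -/
theorem eq_zero_of_hasSum_dilation {τ d : ℕ → ℝ} {ρ C : ℝ} (hτ0 : τ 0 = 0) (hρ : ρ < τ 1)
    (hτ : ∀ s : Finset ℕ, (∀ k ∈ s, 2 ≤ k) → ∑ k ∈ s, |τ k| ≤ ρ) (hd : ∀ m, |d m| ≤ C)
    (h : ∀ m, 1 ≤ m → HasSum (fun k => τ k * d (m * k)) 0) {m : ℕ} (hm : 1 ≤ m) : d m = 0 := by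
  have hρ0 : 0 ≤ ρ := by simpa using hτ ∅ (by simp)
  -- The supremum skips `d 0`, about which the equations say nothing since `τ 0 = 0`.
  have hbdd : BddAbove (range fun m => |d (m + 1)|) := ⟨C, by rintro _ ⟨m, rfl⟩; exact hd _⟩
  set M := ⨆ m, |d (m + 1)| with hM
  have hle : ∀ l, 1 ≤ l → |d l| ≤ M := fun l hl => by
    have := le_ciSup hbdd (l - 1)
    rwa [Nat.sub_add_cancel hl] at this
  have hM0 : 0 ≤ M := (abs_nonneg _).trans (hle 1 le_rfl)
  have hstep : ∀ l, 1 ≤ l → τ 1 * |d l| ≤ ρ * M := by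
    intro l hl
    -- Isolating the term `k = 1` gives `τ 1 |d l| ≤ ρ M`; as `ρ < τ 1`, this forces the supremum
    -- `M` to vanish.
    have h1 := (h l hl).sub (hasSum_ite_eq 1 (τ 1 * d l))
    have h2 : |0 - τ 1 * d l| ≤ ρ * M := by
      refine le_of_tendsto h1.abs (Eventually.of_forall fun s => ?_)
      refine (Finset.abs_sum_le_sum_abs _ _).trans ?_
      refine le_trans ?_ (mul_le_mul_of_nonneg_right
        (hτ (s.filter (2 ≤ ·)) fun k hk => (Finset.mem_filter.1 hk).2) hM0)
      rw [Finset.sum_mul, Finset.sum_filter]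
      refine Finset.sum_le_sum fun k _ => ?_
      match k with
      | 0 => simp [hτ0]
      | 1 => simp
      | k + 2 =>
        rw [if_neg (by omega), if_pos (by omega), sub_zero, abs_mul]
        exact mul_le_mul_of_nonneg_left (hle _ (Nat.mul_pos hl (by omega))) (abs_nonneg _)
    rwa [zero_sub, abs_neg, abs_mul, abs_of_pos (hρ0.trans_lt hρ)] at h2
  have hMle : M ≤ ρ * M / τ 1 := ciSup_le fun l => by
    rw [le_div_iff₀ (hρ0.trans_lt hρ), mul_comm]
    exact hstep _ (by omega)
  rw [le_div_iff₀ (hρ0.trans_lt hρ)] at hMle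
  have hM1 : M ≤ 0 := by
    by_contra! hpos
    nlinarith
  exact abs_eq_zero.1 (le_antisymm ((hle m hm).trans hM1) (abs_nonneg _))

/-- The solution of `∑ₖ τ k * c (m * k) = δ_{m j}` for a prime `j`. -/
theorem hasSum_dilation_of_prime {τ : ℕ → ℝ} (hτ1 : τ 1 ≠ 0) {j : ℕ} (hj : j.Prime) {m : ℕ}
    (hm : 1 ≤ m) :
    HasSum (fun k => τ k * (if m * k = 1 then -(τ j * (τ 1)⁻¹ ^ 2) else
      if m * k = j then (τ 1)⁻¹ else 0)) (if m = j then 1 else 0) := by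
  have hj1 : j ≠ 1 := hj.one_lt.ne'
  rcases eq_or_ne m 1 with rfl | hm1
  · have h1 := (hasSum_ite_eq 1 (τ 1 * -(τ j * (τ 1)⁻¹ ^ 2))).add (hasSum_ite_eq j (τ j * (τ 1)⁻¹))
    rw [if_neg hj1.symm]
    convert h1 using 1
    · ext k
      rcases eq_or_ne k 1 with rfl | hk
      · simp [hj1.symm]
      · rcases eq_or_ne k j with rfl | hk' <;> simp [*]
    · field_simp
      ring
  · rcases eq_or_ne m j with rfl | hmj
    · have h1 := hasSum_ite_eq 1 (τ 1 * (τ 1)⁻¹)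
      rw [mul_inv_cancel₀ hτ1] at h1
      rw [if_pos rfl]
      refine h1.congr_fun fun k => ?_
      rcases eq_or_ne k 1 with rfl | hk
      · simp [hj1, hτ1]
      · simp [hk, hj1, hj.ne_zero]
    · rw [if_neg hmj]
      refine hasSum_zero.congr_fun fun k => ?_
      have e1 : m * k ≠ 1 := fun h => hm1 (Nat.eq_one_of_mul_eq_one_right h)
      -- Primality enters here: no `m` other than `1` and `j` divides `j`.
      have e2 : m * k ≠ j := fun h => by
        rcases (Nat.dvd_prime hj).1 ⟨k, h.symm⟩ with h | h
        · exact hm1 h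
        · exact hmj h
      simp [e1, e2]

theorem lemma3p2 (q : ℝ) (hq : 12 / 11 ≤ q)
    (f : ℕ → ℝ → ℝ) (hf : ∀ n, 1 ≤ n → IsQSine q n (f n))
    (fd : ℕ → ℝ → ℝ) (hfd : IsDualFamily f fd)
    (j : ℕ) (hj : j.Prime) :
    sineCoeff (f 1) 1 ≠ 0 ∧
      innerL2 (sineBasis 1) (fd j) = -(sineCoeff (f 1) j * (sineCoeff (f 1) 1)⁻¹ ^ 2) := by
  have hq1 : 1 < q := by linarith
  have hF := hf 1 le_rfl
  obtain ⟨ρ, hρ, hτ⟩ := hF.exists_sum_abs_sineCoeff_le hq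
  have hτ1 : sineCoeff (f 1) 1 ≠ 0 := (hF.sineCoeff_one_pos hq1).ne'
  refine ⟨hτ1, ?_⟩
  have hh : IntegrableOn (fd j) (Ioo 0 1) :=
    (hfd.memLp j hj.one_lt.le).integrable one_le_two
  set c : ℕ → ℝ := fun l => if l = 1 then -(sineCoeff (f 1) j * (sineCoeff (f 1) 1)⁻¹ ^ 2) else
    if l = j then (sineCoeff (f 1) 1)⁻¹ else 0 with hc
  set C := √2 * ∫ x in Ioo (0 : ℝ) 1, ‖fd j x‖ with hC
  have hca : ∀ l, |c l| ≤ |c 1| + |c j| := fun l => by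
    by_cases h1 : l = 1
    · rw [h1]; linarith [abs_nonneg (c j)]
    by_cases h2 : l = j
    · rw [h2]; linarith [abs_nonneg (c 1)]
    · have : c l = 0 := by simp [hc, h1, h2]
      rw [this, abs_zero]
      positivity
  have hzero := eq_zero_of_hasSum_dilation (τ := sineCoeff (f 1))
    (d := fun l => innerL2 (sineBasis l) (fd j) - c l) (C := C + (|c 1| + |c j|))
    (hF.sineCoeff_of_even hq1 Even.zero) hρ hτ
    (fun l => (abs_sub _ _).trans (add_le_add (abs_innerL2_sineBasis_le hh l) (hca l)))
    (fun m hm => by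
      have h1 := hF.hasSum_innerL2 hq hm (hf m hm) hh
      rw [hfd.inner_eq m j hm hj.one_lt.le] at h1
      simpa only [mul_sub, sub_self] using h1.sub (hasSum_dilation_of_prime hτ1 hj hm))
    le_rfl
  simpa [hc] using sub_eq_zero.1 hzero
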